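/- **Setting.** Let $d\ge 1$, let $f:\mathbb R^d\to\mathbb R$, let $\mathbb P_\xi$ be a probability distribution on a measurable space $\mathsf Z$, and let $\nabla F:\mathbb R^d\times\mathsf Z\to\mathbb R^d$ be a measurable stochastic gradient. Norms are Euclidean norms and the associated operator norms. Assume the following. * *Strong convexity.* $f$ is $C^1$ and, for some $\mu>0$, $\frac{\mu}{2}\|\theta-\theta'\|^2\le f(\theta)-f(\theta')-\langle\nabla f(\theta'),\theta-\theta'\rangle$ for all $\theta,\theta'$. Let $\theta^\star$ be the minimizer of $f$. * *Smoothness.* $f$ is $C^4$, $\nabla f$ is $L_2$-Lipschitz, and $\|\nabla^i f(\theta)\|\le L_i$ for all $\theta$ and $i\in\{3,4\}$. * *Noise (order $6$).* $\mathsf E[\nabla F(\theta,\xi)]=\nabla f(\theta)$ for $\xi\sim\mathbb P_\xi$ and all $\theta$; $\mathsf E^{1/6}[\|\nabla F(\theta^\star,\xi)\|^6]\le\tau_6$; and for some $L_1>0$, all $q\in\{2,\dots,6\}$ and all $\theta_1,\theta_2$, $$L_1^{q-1}\|\theta_1-\theta_2\|^{q-2}\langle\nabla f(\theta_1)-\nabla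 f(\theta_2),\theta_1-\theta_2\rangle\ge\mathsf E[\|\nabla F(\theta_1,\xi)-\nabla F(\theta_2,\xi)\|^q].$$ Put $L=\max(L_1,L_2,L_3,L_4)$. On a probability space let $\theta_0\sim\nu$, where $\nu$ is any probability distribution on $\mathbb R^d$, and let $(\xi_k)$ be i.i.d. with law $\mathbb P_\xi$ and independent of $\theta_0$. For a step size $\gamma>0$ set $\theta^{(\gamma)}_0=\theta_0$ and $$\theta^{(\gamma)}_{k+1}=\theta^{(\gamma)}_k-\gamma\nabla F(\theta^{(\gamma)}_k,\xi_{k+1}),\qquad \bar\theta^{(\gamma)}_n=\frac1n\sum_{k=n+1}^{2n}\theta^{(\gamma)}_k,\qquad \bar\theta^{(RR)}_n=2\bar\theta^{(\gamma)}_n-\bar\theta^{(2\gamma)}_n .$$ * *Moment condition (order $6$).* There are constants $D_6,C_6\ge2$ such that for every $\gamma\in(0,1/(LC_6)]$, every initial distribution $\nu$ and every $k\ge0$, $$\mathsf E_\nu^{1/3}[\|\theta^{(\gamma)}_k-\theta^\star\|^6]\le(1-\gamma\mu)^k\,\mathsf E_\nu^{1/3}[\|\theta_0-\theta^\star\|^6]+\frac{D_6\gamma\tau_6^2}{\mu},$$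 and $\mathsf E^{1/3}[\|\theta-\theta^\star\|^6]\le D_6\gamma\tau_6^2/\mu$ when $\theta$ has the stationary distribution of the chain $(\theta_k^{(\gamma)})_k$. Let $H^\star=\nabla^2f(\theta^\star)$ and $\Sigma^\star_\varepsilon=\mathsf E[\nabla F(\theta^\star,\xi)\nabla F(\theta^\star,\xi)^\top]$. Let $\tau_4$ be any number with $\mathsf E^{1/4}[\|\nabla F(\theta^\star,\xi)\|^4]\le\tau_4$, let $D_4\ge2$ be any real number (for example the constant in the fourth-order analogue of the moment condition), and set $$\mathcal R_4(n,\gamma)=\frac{L(1-\gamma\mu)^{(n+1)/2}}{n\gamma\mu}\Bigl(\mathsf E_\nu^{1/2}[\|\theta_0-\theta^\star\|^6]+\mathsf E_\nu^{1/2}[\|\theta_0-\theta^\star\|^4]+\mathsf E_\nu^{1/2}[\|\theta_0-\theta^\star\|^2]+\frac{D_4\gamma\tau_4^2}{\mu}\Bigr).$$ **Corollary.** There are an absolute constant $c_0>0$ and a quantity $C=C(\mu,L,\tau_6,D_6,C_6)$, depending only on the listed parameters, such that in the above setting, for all $n\ge(LC_6)^2$ and with the step size $\gamma=n^{-1/2}$,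 $$\mathsf E_\nu^{1/2}\bigl[\|H^\star(\bar\theta^{(RR)}_n-\theta^\star)\|^2\bigr]\le c_0\Bigl(\frac{\sqrt{\operatorname{Tr}\Sigma^\star_\varepsilon}}{n^{1/2}}+C\,n^{-3/4}+\mathcal R_4(n,n^{-1/2})\Bigr).$$ (Expectations take values in $[0,\infty]$; the bound is trivial if $\nu$ has infinite sixth moment.) -/

import Mathlib

open MeasureTheory ProbabilityTheory
open scoped ENNReal

noncomputable section

namespace SGDRR

/-- The Euclidean space `ℝ^d`. -/
abbrev E (d : ℕ) : Type := EuclideanSpace ℝ (Fin d)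

/-- `f` is continuously differentiable and `μ`-strongly convex, in first-order form. -/
structure StronglyConvex {d : ℕ} (f : E d → ℝ) (μ : ℝ) : Prop where
  pos : 0 < μ
  contDiff : ContDiff ℝ 1 f
  lower : ∀ θ θ' : E d,
    μ / 2 * ‖θ - θ'‖ ^ 2 ≤ f θ - f θ' - inner ℝ (gradient f θ') (θ - θ')

/-- `f` is four times continuously differentiable, its gradient is `L₂`-Lipschitz, and its third
and fourth derivatives are bounded (in operator norm) by `L₃` and `L₄`. -/
structure Smooth {d : ℕ} (f : E d → ℝ) (L₂ L₃ L₄ : ℝ) : Prop where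
  contDiff : ContDiff ℝ 4 f
  nonneg₂ : 0 ≤ L₂
  nonneg₃ : 0 ≤ L₃
  nonneg₄ : 0 ≤ L₄
  lipschitz : ∀ θ θ' : E d, ‖gradient f θ - gradient f θ'‖ ≤ L₂ * ‖θ - θ'‖
  bound₃ : ∀ θ : E d, ‖iteratedFDeriv ℝ 3 f θ‖ ≤ L₃
  bound₄ : ∀ θ : E d, ‖iteratedFDeriv ℝ 4 f θ‖ ≤ L₄

section Noise

variable {d : ℕ} {Z : Type*} [MeasurableSpace Z]

/-- The noise level at `θs`: `E^{1/p} ‖∇F(θs, ξ)‖^p ≤ τ` for `ξ ∼ Pξ`. -/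
def NoiseMomentBound (gradF : E d → Z → E d) (Pξ : Measure Z) (θs : E d) (p : ℕ) (τ : ℝ) : Prop :=
  0 ≤ τ ∧ eLpNorm (gradF θs) p Pξ ≤ ENNReal.ofReal τ

/-- The assumption of order `p` on the stochastic gradient `∇F` : it is (jointly measurable and)
unbiased for `∇f`, its `p`-th moment at `θs` is at most `τ ^ p`, and it is `L₁`-co-coercive of every
order `q = 2, …, p`. The moment bounds are stated with the Lebesgue integral in `[0, ∞]`, so they
include finiteness of the moments. -/
structure NoiseAssumption (f : E d → ℝ) (gradF : E d → Z → E d) (Pξ : Measure Z)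
    (θs : E d) (p : ℕ) (L₁ τ : ℝ) : Prop where
  measurable : Measurable (Function.uncurry gradF)
  unbiased : ∀ θ : E d, ∫ z, gradF θ z ∂Pξ = gradient f θ
  moment : NoiseMomentBound gradF Pξ θs p τ
  pos : 0 < L₁
  cocoercive : ∀ q : ℕ, 2 ≤ q → q ≤ p → ∀ θ₁ θ₂ : E d,
    ∫⁻ z, ‖gradF θ₁ z - gradF θ₂ z‖ₑ ^ q ∂Pξ ≤
      ENNReal.ofReal (L₁ ^ (q - 1) * ‖θ₁ - θ₂‖ ^ (q - 2) *
        inner ℝ (gradient f θ₁ - gradient f θ₂) (θ₁ - θ₂))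

/-- One step `ν ↦ ν Q_γ` of the Markov kernel of constant step size SGD:
the law of `θ - γ ∇F(θ, ξ)` for independent `θ ∼ ν`, `ξ ∼ Pξ`. -/
def stepLaw (gradF : E d → Z → E d) (Pξ : Measure Z) (γ : ℝ) (ν : Measure (E d)) :
    Measure (E d) :=
  (ν.prod Pξ).map (fun x => x.1 - γ • gradF x.1 x.2)

/-- `ν Q_γ^k`, the law of the `k`-th SGD iterate with step size `γ` and `θ₀ ∼ ν`. -/
def iterLaw (gradF : E d → Z → E d) (Pξ : Measure Z) (γ : ℝ) (ν : Measure (E d)) (k : ℕ) :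
    Measure (E d) :=
  (stepLaw gradF Pξ γ)^[k] ν

/-- `π` is a stationary distribution of SGD with step size `γ`. -/
structure IsStationary (gradF : E d → Z → E d) (Pξ : Measure Z) (γ : ℝ) (π : Measure (E d)) :
    Prop where
  prob : IsProbabilityMeasure π
  invariant : stepLaw gradF Pξ γ π = π

/-- `E^{2/p} ‖θ - θs‖^p ∈ [0, ∞]` for `θ ∼ ν`. -/
def sqMoment (θs : E d) (p : ℕ) (ν : Measure (E d)) : ℝ≥0∞ :=
  (∫⁻ θ, ‖θ - θs‖ₑ ^ p ∂ν) ^ (2 / (p : ℝ))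

/-- The moment condition of order `p` with constants `D` and `c`: for every
step size `γ ∈ (0, 1 / (L c)]`, a geometric `p`-th moment bound along the SGD iterates from every
initial distribution, and the corresponding bound for the stationary distribution. -/
structure MomentCondition (gradF : E d → Z → E d) (Pξ : Measure Z) (θs : E d)
    (p : ℕ) (μ L τ D c : ℝ) : Prop where
  two_le_D : 2 ≤ D
  two_le_c : 2 ≤ c
  iterate : ∀ γ : ℝ, 0 < γ → γ ≤ 1 / (L * c) →
    ∀ ν : Measure (E d), IsProbabilityMeasure ν → ∀ k : ℕ,
      sqMoment θs p (iterLaw gradF Pξ γ ν k) ≤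
        ENNReal.ofReal ((1 - γ * μ) ^ k) * sqMoment θs p ν + ENNReal.ofReal (D * γ * τ ^ 2 / μ)
  stationary : ∀ γ : ℝ, 0 < γ → γ ≤ 1 / (L * c) →
    ∀ π : Measure (E d), IsStationary gradF Pξ γ π →
      sqMoment θs p π ≤ ENNReal.ofReal (D * γ * τ ^ 2 / μ)

/-- The covariance matrix `E [∇F(θs, ξ)^{⊗2}]` of the noise at `θs`. -/
def noiseCov (gradF : E d → Z → E d) (Pξ : Measure Z) (θs : E d) : Matrix (Fin d) (Fin d) ℝ :=
  Matrix.of fun i j => ∫ z, gradF θs z i * gradF θs z j ∂Pξ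

/-- The Hessian `∇²f(θ)` as a linear operator: the derivative of the gradient. -/
def hessian (f : E d → ℝ) (θ : E d) : E d →L[ℝ] E d :=
  fderiv ℝ (gradient f) θ

variable {Ω : Type*}

/-- The SGD iterates `θ_{k+1} = θ_k - γ ∇F(θ_k, ξ_{k+1})` with constant step size `γ`. -/
def sgd (gradF : E d → Z → E d) (γ : ℝ) (θ₀ : Ω → E d) (ξ : ℕ → Ω → Z) : ℕ → Ω → E d
  | 0 => θ₀
  | k + 1 => fun ω =>
      sgd gradF γ θ₀ ξ k ω - γ • gradF (sgd gradF γ θ₀ ξ k ω) (ξ (k + 1) ω)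

/-- The tail average `n⁻¹ ∑_{k=n+1}^{2n} θ_k`. -/
def tailAverage (gradF : E d → Z → E d) (γ : ℝ) (θ₀ : Ω → E d) (ξ : ℕ → Ω → Z) (n : ℕ) (ω : Ω) :
    E d :=
  (n : ℝ)⁻¹ • ∑ k ∈ Finset.Icc (n + 1) (2 * n), sgd gradF γ θ₀ ξ k ω

/-- The Richardson-Romberg estimator, from two chains with step sizes `γ` and `2 γ` driven by the
same starting point and the same noise. -/
def richardsonRomberg (gradF : E d → Z → E d) (γ : ℝ) (θ₀ : Ω → E d) (ξ : ℕ → Ω → Z) (n : ℕ)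
    (ω : Ω) : E d :=
  (2 : ℝ) • tailAverage gradF γ θ₀ ξ n ω - tailAverage gradF (2 * γ) θ₀ ξ n ω

end Noise

/-- `E_ν^{1/2} ‖θ₀ - θs‖^q ∈ [0, ∞]`. -/
def rootMoment {d : ℕ} (θs : E d) (q : ℕ) (ν : Measure (E d)) : ℝ≥0∞ :=
  (∫⁻ θ, ‖θ - θs‖ₑ ^ q ∂ν) ^ (1 / 2 : ℝ)

/-- The remainder term `R₄(n, γ, ‖θ₀ - θs‖)` for `θ₀ ∼ ν`, with values in `[0, ∞]`. -/
def remainder₄ {d : ℕ} (θs : E d) (μ L τ₄ D₄ : ℝ) (n : ℕ) (γ : ℝ) (ν : Measure (E d)) : ℝ≥0∞ :=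
  ENNReal.ofReal (L * (1 - γ * μ) ^ (((n : ℝ) + 1) / 2) / (n * γ * μ)) *
    (rootMoment θs 6 ν + rootMoment θs 4 ν + rootMoment θs 2 ν +
      ENNReal.ofReal (D₄ * γ * τ₄ ^ 2 / μ))

end SGDRR

end

/-! Split the error at the minimizer: run a second chain from `θs` with the same noise.
Co-coercivity of order 2 makes one common-noise step an L² contraction by `√(1 - η μ)`, so the two
tail averages differ by a geometric tail. This gives the remainder term, and it uses only the second
moment of the starting point (`Driven.lpBound_hessian_richardsonRomberg_sub`).

For the chain started at `θs`, write `e = θ - θs`, `H` for the Hessian and `T` for the second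
derivative of the gradient at `θs`. The moment condition puts `e` at order `√η` in L⁶. The drift is
`H e + ½ T(e, e) + O(‖e‖³)`, and the quadratic term is too large to be estimated directly. It is
removed by a corrector: let `B` solve `B(H u, v) + B(u, H v) = T(u, v)`, possible with `‖B‖ ≤ L / μ`
because `H` is coercive (`exists_lyapunov_solution`), and follow the potential `e - ½ B(e, e)`.
Along a step, `½ T(e, e)` cancels, so that `H e` equals a telescoping term, plus a martingale
increment, minus `(η / 2) B(G, G)` with `G = gradF θs ξ`, plus a residual of order `‖e‖³ + η ‖e‖` up
to noise factors (`residual_eq`, `hessian_tailAverage_eq`).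

The term in `B(G, G)` is the bias of first order in `η`. It depends on the noise alone and is
exactly linear in `η`, and both chains see the same noise; hence the combination of steps `γ` and
`2γ` cancels it path by path. No stationary law is needed, nor a centering of `B(G, G)`.

With `q = n^{-1/4}` one has `γ = q²`, `1/n = q⁴` and `e` of order `q`. Telescoping and residual
terms are then `O(q³)`, while orthogonality gives the martingale `q² √(Tr Σ) + O(q³)`. If the
doubled step leaves the range of the moment condition, `n` is bounded in terms of `L c₆`, and a
rate-free L² bound is absorbed into the constant. -/

noncomputable section

namespace SGDRR

/-! ### Taylor remainders with non-sharp constants -/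

section Taylor

variable {V W : Type*} [NormedAddCommGroup V] [NormedSpace ℝ V]
  [NormedAddCommGroup W] [NormedSpace ℝ W]

/-- A function whose derivative at `y` is at most `K * ‖y - x‖ ^ k` moves by at most
`K * ‖y - x‖ ^ (k + 1)` away from `x`. -/
theorem norm_sub_le_of_fderiv_bound {h : V → W} {x : V} {K : ℝ} {k : ℕ} (hK : 0 ≤ K)
    (hd : Differentiable ℝ h) (hb : ∀ y, ‖fderiv ℝ h y‖ ≤ K * ‖y - x‖ ^ k) (y : V) :
    ‖h y - h x‖ ≤ K * ‖y - x‖ ^ (k + 1) := by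
  have key := Convex.norm_image_sub_le_of_norm_hasFDerivWithin_le (𝕜 := ℝ) (f := h)
    (C := K * ‖y - x‖ ^ k) (s := Metric.closedBall x ‖y - x‖) (x := x) (y := y)
    (fun z _ => (hd z).hasFDerivAt.hasFDerivWithinAt)
    (fun z hz => (hb z).trans (by
      rw [Metric.mem_closedBall, dist_eq_norm] at hz
      gcongr))
    (convex_closedBall x _) (Metric.mem_closedBall_self (norm_nonneg _))
    (by rw [Metric.mem_closedBall, dist_eq_norm])
  rw [pow_succ, ← mul_assoc]
  exact key

theorem norm_sub_le_of_fderiv_le {h : V → W} {K : ℝ} (hd : Differentiable ℝ h)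
    (hb : ∀ y, ‖fderiv ℝ h y‖ ≤ K) (x y : V) : ‖h y - h x‖ ≤ K * ‖y - x‖ := by
  have hK : 0 ≤ K := (norm_nonneg _).trans (hb x)
  simpa using norm_sub_le_of_fderiv_bound (k := 0) hK hd (by simpa using hb) y

/-- First-order Taylor bound. -/
theorem norm_taylor_one_le {h : V → W} {K : ℝ} (hK : 0 ≤ K) (hd : Differentiable ℝ h) {x : V}
    (hb : ∀ y, ‖fderiv ℝ h y - fderiv ℝ h x‖ ≤ K * ‖y - x‖) (y : V) :
    ‖h y - h x - fderiv ℝ h x (y - x)‖ ≤ K * ‖y - x‖ ^ 2 := by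
  have hder : ∀ z, HasFDerivAt (fun z => h z - fderiv ℝ h x (z - x))
      (fderiv ℝ h z - fderiv ℝ h x) z := fun z =>
    (hd z).hasFDerivAt.sub
      ((fderiv ℝ h x).hasFDerivAt.comp z ((hasFDerivAt_id z).sub_const x))
  have key := norm_sub_le_of_fderiv_bound (h := fun z => h z - fderiv ℝ h x (z - x)) (x := x)
    (k := 1) hK (fun z => (hder z).differentiableAt)
    (fun z => by rw [(hder z).fderiv, pow_one]; exact hb z) y
  simp only [sub_self, map_zero, sub_zero] at key
  calc _ = ‖h y - fderiv ℝ h x (y - x) - h x‖ := by congr 1; abel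
    _ ≤ _ := key

/-- Second-order Taylor bound. -/
theorem norm_taylor_two_le {h : V → W} {K : ℝ} (hd : Differentiable ℝ h)
    {x : V} {T : V →L[ℝ] V →L[ℝ] W}
    (hb : ∀ y, ‖fderiv ℝ h y - fderiv ℝ h x - T (y - x)‖ ≤ K * ‖y - x‖ ^ 2) (y : V) :
    ‖h y - h x - fderiv ℝ h x (y - x) - (1 / 2 : ℝ) • T (y - x) (y - x)‖ ≤ K * ‖y - x‖ ^ 3 := by
  set w := y - x with hw
  -- The remainder is restricted to the segment from `x` to `y`, where its derivative in `t` is the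
  -- first-order remainder of `fderiv ℝ h` applied to `w`.
  have hder : ∀ t : ℝ, HasDerivAt
      (fun t : ℝ => h (x + t • w) - t • fderiv ℝ h x w - (t ^ 2 / 2) • T w w)
      (fderiv ℝ h (x + t • w) w - fderiv ℝ h x w - t • T w w) t := by
    intro t
    have h1 : HasDerivAt (fun t : ℝ => x + t • w) w t := by
      simpa using ((hasDerivAt_id t).smul_const w).const_add x
    have h2 := (hd (x + t • w)).hasFDerivAt.comp_hasDerivAt t h1
    have h3 : HasDerivAt (fun t : ℝ => t • fderiv ℝ h x w) (fderiv ℝ h x w) t := by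
      simpa using (hasDerivAt_id t).smul_const (fderiv ℝ h x w)
    have h4 : HasDerivAt (fun t : ℝ => (t ^ 2 / 2) • T w w) (t • T w w) t := by
      have : HasDerivAt (fun t : ℝ => t ^ 2 / 2) t t := by
        simpa using (hasDerivAt_pow 2 t).div_const 2
      exact this.smul_const (T w w)
    exact (h2.sub h3).sub h4
  have hK : 0 ≤ K * ‖w‖ ^ 3 := by
    have := (norm_nonneg _).trans (hb y)
    rw [← hw] at this
    calc (0 : ℝ) ≤ K * ‖w‖ ^ 2 * ‖w‖ := by positivity
      _ = _ := by ring
  have key := norm_image_sub_le_of_norm_deriv_le_segment_01'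
    (f := fun t : ℝ => h (x + t • w) - t • fderiv ℝ h x w - (t ^ 2 / 2) • T w w)
    (f' := fun t => fderiv ℝ h (x + t • w) w - fderiv ℝ h x w - t • T w w)
    (C := K * ‖w‖ ^ 3) (fun t _ => (hder t).hasDerivWithinAt) (fun t ht => by
      have h1 := hb (x + t • w)
      rw [add_sub_cancel_left] at h1
      have h2 : fderiv ℝ h (x + t • w) w - fderiv ℝ h x w - t • T w w
          = (fderiv ℝ h (x + t • w) - fderiv ℝ h x - T (t • w)) w := by simp
      rw [h2]
      calc _ ≤ ‖fderiv ℝ h (x + t • w) - fderiv ℝ h x - T (t • w)‖ * ‖w‖ :=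
            ContinuousLinearMap.le_opNorm _ _
        _ ≤ K * ‖t • w‖ ^ 2 * ‖w‖ := by gcongr
        _ = t ^ 2 * (K * ‖w‖ ^ 3) := by
            rw [norm_smul, mul_pow, Real.norm_eq_abs, sq_abs]; ring
        _ ≤ 1 * (K * ‖w‖ ^ 3) := by
            gcongr
            exact pow_le_one₀ ht.1 ht.2.le
        _ = _ := one_mul _)
  simp only [one_smul, one_pow, zero_smul, add_zero, sub_zero] at key
  have hxy : x + w = y := by rw [hw]; abel
  rw [hxy] at key
  convert key using 2
  simp
  abel

theorem norm_taylor_one_le_of_contDiff {h : V → W} {K : ℝ} (hc : ContDiff ℝ 2 h)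
    (hb : ∀ x, ‖iteratedFDeriv ℝ 2 h x‖ ≤ K) (x y : V) :
    ‖h y - h x - fderiv ℝ h x (y - x)‖ ≤ K * ‖y - x‖ ^ 2 := by
  have h1 : ContDiff ℝ 1 (fderiv ℝ h) := hc.fderiv_right (by norm_num)
  refine norm_taylor_one_le ((norm_nonneg _).trans (hb x)) (hc.differentiable (by norm_num))
    (norm_sub_le_of_fderiv_le (h1.differentiable (by norm_num)) (fun z => ?_) x) y
  rw [← norm_iteratedFDeriv_one, norm_iteratedFDeriv_fderiv]
  exact hb z

theorem norm_taylor_two_le_of_contDiff {h : V → W} {K : ℝ} (hc : ContDiff ℝ 3 h)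
    (hb : ∀ x, ‖iteratedFDeriv ℝ 3 h x‖ ≤ K) (x y : V) :
    ‖h y - h x - fderiv ℝ h x (y - x)
      - (1 / 2 : ℝ) • fderiv ℝ (fderiv ℝ h) x (y - x) (y - x)‖ ≤ K * ‖y - x‖ ^ 3 := by
  have h1 : ContDiff ℝ 2 (fderiv ℝ h) := hc.fderiv_right (by norm_num)
  refine norm_taylor_two_le (hc.differentiable (by norm_num))
    (norm_taylor_one_le_of_contDiff h1 (fun z => ?_) x) y
  rw [norm_iteratedFDeriv_fderiv]
  exact hb z

end Taylor

/-! ### The Lyapunov equation for bilinear maps -/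

section Lyapunov

variable {V : Type*} [NormedAddCommGroup V] [InnerProductSpace ℝ V]

/-- The Lyapunov operator `X ↦ X(H ·, ·) + X(·, H ·)` on bilinear maps. -/
def lyapunov (H : V →L[ℝ] V) : (V →L[ℝ] V →L[ℝ] V) →ₗ[ℝ] (V →L[ℝ] V →L[ℝ] V) where
  toFun X := X.bilinearComp H (.id ℝ V) + X.bilinearComp (.id ℝ V) H
  map_add' X Y := by ext u v; simp; abel
  map_smul' a X := by ext u v; simp

theorem lyapunov_apply (H : V →L[ℝ] V) (X : V →L[ℝ] V →L[ℝ] V) (u v : V) :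
    lyapunov H X u v = X (H u) v + X u (H v) := by
  simp [lyapunov]

/-- `c - H` contracts for `c = L² / μ` when `H` is coercive and bounded. -/
theorem norm_smul_sub_le_of_coercive {H : V →L[ℝ] V} {μ L : ℝ} (hμ : 0 < μ) (hL : 0 < L)
    (hμL : μ ≤ L) (hcoer : ∀ v, μ * ‖v‖ ^ 2 ≤ inner ℝ (H v) v) (hH : ‖H‖ ≤ L) (v : V) :
    ‖(L ^ 2 / μ) • v - H v‖ ≤ (L ^ 2 / μ - μ / 2) * ‖v‖ := by
  have hc : L ≤ L ^ 2 / μ := by rw [le_div_iff₀ hμ]; nlinarith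
  -- This choice gives `c μ = L²`, so expanding the square leaves at most `c² - 2 c μ + L² = c² -
  -- L²`, which is below `(c - μ / 2)²`.
  set c := L ^ 2 / μ with hcdef
  have hcμ : c * μ = L ^ 2 := by rw [hcdef]; field_simp
  have hHv : ‖H v‖ ≤ L * ‖v‖ := (H.le_opNorm v).trans (by gcongr)
  refine (sq_le_sq₀ (norm_nonneg _) (mul_nonneg (by linarith) (norm_nonneg _))).mp ?_
  have h1 : ‖c • v - H v‖ ^ 2 = c ^ 2 * ‖v‖ ^ 2 - 2 * c * inner ℝ (H v) v + ‖H v‖ ^ 2 := by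
    rw [norm_sub_sq_real, norm_smul, inner_smul_left, real_inner_comm, Real.norm_eq_abs, mul_pow,
      sq_abs]
    simp; ring
  have h2 : ‖H v‖ ^ 2 ≤ L ^ 2 * ‖v‖ ^ 2 := by
    rw [← mul_pow]; gcongr
  have h3 := mul_le_mul_of_nonneg_left (hcoer v) (by linarith : (0 : ℝ) ≤ 2 * c)
  rw [h1]
  have h4 : 2 * c * (μ * ‖v‖ ^ 2) = 2 * L ^ 2 * ‖v‖ ^ 2 := by
    rw [← hcμ]; ring
  have h5 : ((c - μ / 2) * ‖v‖) ^ 2 = c ^ 2 * ‖v‖ ^ 2 - L ^ 2 * ‖v‖ ^ 2 + μ ^ 2 / 4 * ‖v‖ ^ 2 := by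
    rw [← hcμ]; ring
  rw [h5]
  nlinarith [sq_nonneg ‖v‖, sq_nonneg (μ * ‖v‖)]

/-- The Lyapunov operator of a coercive bounded `H` is bounded below. -/
theorem norm_le_norm_lyapunov {H : V →L[ℝ] V} {μ L : ℝ} (hμ : 0 < μ) (hL : 0 < L)
    (hμL : μ ≤ L) (hcoer : ∀ v, μ * ‖v‖ ^ 2 ≤ inner ℝ (H v) v) (hH : ‖H‖ ≤ L)
    (X : V →L[ℝ] V →L[ℝ] V) : μ * ‖X‖ ≤ ‖lyapunov H X‖ := by
  have hc : L ≤ L ^ 2 / μ := by rw [le_div_iff₀ hμ]; nlinarith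
  have hkey := norm_smul_sub_le_of_coercive hμ hL hμL hcoer hH
  set c := L ^ 2 / μ
  have hA : 0 ≤ c - μ / 2 := by linarith
  have hbd : ∀ u v : V, ‖X u v‖ ≤
      ((‖lyapunov H X‖ + 2 * (c - μ / 2) * ‖X‖) / (2 * c)) * ‖u‖ * ‖v‖ := by
    intro u v
    -- Each slot trades `H` for the contraction `c - H`, whence `2c ‖X‖ ≤ ‖lyapunov H X‖ + (2c - μ)
    -- ‖X‖`. Symmetry of `H` plays no role.
    have hid : (2 * c) • X u v
        = lyapunov H X u v + X (c • u - H u) v + X u (c • v - H v) := by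
      rw [lyapunov_apply]
      simp only [map_sub, map_smul, sub_apply, smul_apply]
      rw [two_mul, add_smul]
      abel
    have hn : 2 * c * ‖X u v‖ ≤
        (‖lyapunov H X‖ + 2 * (c - μ / 2) * ‖X‖) * ‖u‖ * ‖v‖ := by
      have : ‖(2 * c) • X u v‖ = 2 * c * ‖X u v‖ := by
        rw [norm_smul, Real.norm_of_nonneg (by linarith)]
      rw [← this, hid]
      calc _ ≤ ‖lyapunov H X u v‖ + ‖X (c • u - H u) v‖ + ‖X u (c • v - H v)‖ := norm_add₃_le
        _ ≤ ‖lyapunov H X‖ * ‖u‖ * ‖v‖ + ‖X‖ * ‖c • u - H u‖ * ‖v‖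
            + ‖X‖ * ‖u‖ * ‖c • v - H v‖ := by
          gcongr <;> exact ContinuousLinearMap.le_opNorm₂ _ _ _
        _ ≤ ‖lyapunov H X‖ * ‖u‖ * ‖v‖ + ‖X‖ * ((c - μ / 2) * ‖u‖) * ‖v‖
            + ‖X‖ * ‖u‖ * ((c - μ / 2) * ‖v‖) := by
          gcongr
          · exact hkey u
          · exact hkey v
        _ = _ := by ring
    rw [div_mul_eq_mul_div, div_mul_eq_mul_div, le_div_iff₀ (by linarith)]
    linarith
  have := ContinuousLinearMap.opNorm_le_bound₂ X
    (by have := norm_nonneg (lyapunov H X); have := norm_nonneg X; positivity) hbd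
  rw [le_div_iff₀ (by linarith)] at this
  nlinarith

/-- Solvability of the Lyapunov equation `X(H u, v) + X(u, H v) = T(u, v)` with the bound
`‖X‖ ≤ ‖T‖ / μ`. -/
theorem exists_lyapunov_solution [FiniteDimensional ℝ V] {H : V →L[ℝ] V} {μ L : ℝ} (hμ : 0 < μ)
    (hL : 0 < L) (hμL : μ ≤ L) (hcoer : ∀ v, μ * ‖v‖ ^ 2 ≤ inner ℝ (H v) v) (hH : ‖H‖ ≤ L)
    (T : V →L[ℝ] V →L[ℝ] V) :
    ∃ X : V →L[ℝ] V →L[ℝ] V, (∀ u v, X (H u) v + X u (H v) = T u v) ∧ ‖X‖ ≤ ‖T‖ / μ := by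
  have hbelow := norm_le_norm_lyapunov hμ hL hμL hcoer hH
  have hinj : Function.Injective (lyapunov H) := by
    rw [← LinearMap.ker_eq_bot, LinearMap.ker_eq_bot']
    intro X hX
    have := hbelow X
    rw [hX] at this
    have h0 : ‖X‖ ≤ 0 := by
      by_contra! h
      have h1 : ‖(0 : V →L[ℝ] V →L[ℝ] V)‖ = 0 := ContinuousLinearMap.opNorm_zero
      nlinarith [mul_pos hμ h]
    ext1 u
    ext1 v
    have h1 : ‖X u v‖ ≤ 0 := (X.le_opNorm₂ u v).trans (by
      rw [le_antisymm h0 (ContinuousLinearMap.opNorm_nonneg X)]; simp)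
    simpa using h1
  obtain ⟨X, hX⟩ := LinearMap.injective_iff_surjective.mp hinj T
  refine ⟨X, fun u v => by rw [← lyapunov_apply, hX], ?_⟩
  rw [le_div_iff₀ hμ, ← hX, mul_comm]
  exact hbelow X

end Lyapunov

/-! ### Derivatives of the objective -/

section Objective

variable {d : ℕ} {f : E d → ℝ} {μ L₂ L₃ L₄ : ℝ}

theorem Smooth.contDiff_gradient (h : Smooth f L₂ L₃ L₄) : ContDiff ℝ 3 (gradient f) := by
  have h1 : ContDiff ℝ 3 (fderiv ℝ f) := h.contDiff.fderiv_right (by norm_num)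
  exact (InnerProductSpace.toDual ℝ (E d)).symm.contDiff.comp h1

/-- The gradient is the Riesz isometry composed with `fderiv ℝ f`, so bounds on derivatives of `f`
pass to it with the order lowered by one. -/
theorem norm_iteratedFDeriv_gradient (k : ℕ) (θ : E d) :
    ‖iteratedFDeriv ℝ k (gradient f) θ‖ = ‖iteratedFDeriv ℝ (k + 1) f θ‖ := by
  rw [← norm_iteratedFDeriv_fderiv]
  exact LinearIsometryEquiv.norm_iteratedFDeriv_comp_left
    (InnerProductSpace.toDual ℝ (E d)).symm (fderiv ℝ f) θ k

theorem norm_hessian_le (h : Smooth f L₂ L₃ L₄) (θ : E d) : ‖hessian f θ‖ ≤ L₂ := by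
  have : LipschitzWith ⟨L₂, h.nonneg₂⟩ (gradient f) :=
    LipschitzWith.of_dist_le_mul fun x y => by
      rw [dist_eq_norm, dist_eq_norm]; exact h.lipschitz x y
  exact norm_fderiv_le_of_lipschitz ℝ this

theorem norm_fderiv_hessian_le (h : Smooth f L₂ L₃ L₄) (θ : E d) :
    ‖fderiv ℝ (fderiv ℝ (gradient f)) θ‖ ≤ L₃ := by
  rw [← norm_iteratedFDeriv_one, norm_iteratedFDeriv_fderiv, norm_iteratedFDeriv_gradient]
  exact h.bound₃ θ

theorem gradient_taylor_one (h : Smooth f L₂ L₃ L₄) (x y : E d) :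
    ‖gradient f y - gradient f x - hessian f x (y - x)‖ ≤ L₃ * ‖y - x‖ ^ 2 :=
  norm_taylor_one_le_of_contDiff (h.contDiff_gradient.of_le (by norm_num))
    (fun θ => (norm_iteratedFDeriv_gradient 2 θ).trans_le (h.bound₃ θ)) x y

theorem gradient_taylor_two (h : Smooth f L₂ L₃ L₄) (x y : E d) :
    ‖gradient f y - gradient f x - hessian f x (y - x)
      - (1 / 2 : ℝ) • fderiv ℝ (fderiv ℝ (gradient f)) x (y - x) (y - x)‖ ≤ L₄ * ‖y - x‖ ^ 3 :=
  norm_taylor_two_le_of_contDiff h.contDiff_gradient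
    (fun θ => (norm_iteratedFDeriv_gradient 3 θ).trans_le (h.bound₄ θ)) x y

theorem StronglyConvex.monotone (h : StronglyConvex f μ) (x y : E d) :
    μ * ‖x - y‖ ^ 2 ≤ inner ℝ (gradient f x - gradient f y) (x - y) := by
  have h1 := h.lower x y
  have h2 := h.lower y x
  rw [← neg_sub x y, norm_neg, inner_neg_right] at h2
  rw [inner_sub_left]
  linarith

/-- Differentiate the monotonicity inequality of the gradient along the line `θ + t v`: divide by
`t²` and let `t` decrease to 0. -/
theorem hessian_coercive (h : StronglyConvex f μ) (hs : Smooth f L₂ L₃ L₄) (θ v : E d) :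
    μ * ‖v‖ ^ 2 ≤ inner ℝ (hessian f θ v) v := by
  have hd : HasDerivAt (fun t : ℝ => gradient f (θ + t • v)) (hessian f θ v) 0 := by
    have h1 : HasDerivAt (fun t : ℝ => θ + t • v) v 0 := by
      simpa using ((hasDerivAt_id (0 : ℝ)).smul_const v).const_add θ
    have h2 : HasFDerivAt (gradient f) (hessian f θ) (θ + (0 : ℝ) • v) := by
      rw [zero_smul, add_zero]
      exact (hs.contDiff_gradient.differentiable (by norm_num) θ).hasFDerivAt
    exact h2.comp_hasDerivAt 0 h1
  have ht := hd.tendsto_slope_zero_right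
  refine ge_of_tendsto (ht.inner tendsto_const_nhds) ?_
  filter_upwards [self_mem_nhdsWithin] with t ht0
  have ht0 : 0 < t := ht0
  have h3 := h.monotone (θ + t • v) θ
  rw [add_sub_cancel_left, norm_smul, inner_smul_right, mul_pow, Real.norm_eq_abs, sq_abs] at h3
  simp only [zero_add, zero_smul, add_zero]
  rw [inner_smul_left]
  simp only [conj_trivial]
  rw [inv_mul_eq_div, le_div_iff₀ ht0]
  have : t * (μ * ‖v‖ ^ 2 * t) ≤ t * inner ℝ (gradient f (θ + t • v) - gradient f θ) v := by
    linarith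
  exact le_of_mul_le_mul_left this ht0

theorem gradient_eq_zero_of_isMinOn {θs : E d} (h : IsMinOn f Set.univ θs) :
    gradient f θs = 0 := by
  have : IsLocalMin f θs := h.isLocalMin Filter.univ_mem
  simp [gradient, this.fderiv_eq_zero]

theorem convexity_le_smoothness (hd : 0 < d) (h : StronglyConvex f μ) (hs : Smooth f L₂ L₃ L₄) :
    μ ≤ L₂ := by
  have : Nonempty (Fin d) := ⟨⟨0, hd⟩⟩
  obtain ⟨v, hv⟩ := exists_ne (0 : E d)
  have hv' : 0 < ‖v‖ := norm_pos_iff.mpr hv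
  have h1 := hessian_coercive h hs 0 v
  have h2 : inner ℝ (hessian f 0 v) v ≤ L₂ * ‖v‖ * ‖v‖ :=
    (real_inner_le_norm _ _).trans (by
      gcongr
      exact ((hessian f 0).le_opNorm v).trans (by gcongr; exact norm_hessian_le hs 0))
  by_contra! hlt
  nlinarith [mul_pos hv' hv']

end Objective

/-! ### A calculus of L^p bounds with real constants -/

section LpBound

variable {Ω V : Type*} [MeasurableSpace Ω] [NormedAddCommGroup V] {P : Measure Ω}

theorem eLpNorm_natCast_pow (X : Ω → V) {p : ℕ} (hp : p ≠ 0) :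
    eLpNorm X p P ^ p = ∫⁻ ω, ‖X ω‖ₑ ^ p ∂P := by
  have hp' : (p : ℝ) ≠ 0 := by exact_mod_cast hp
  rw [eLpNorm_eq_lintegral_rpow_enorm_toReal (by exact_mod_cast hp) (ENNReal.natCast_ne_top p),
    ← ENNReal.rpow_natCast, ← ENNReal.rpow_mul]
  simp [hp']

/-- `X` is measurable and `‖X‖_{L^p} ≤ a`. -/
structure LpBound (X : Ω → V) (p : ℝ≥0∞) (P : Measure Ω) (a : ℝ) : Prop where
  meas : AEStronglyMeasurable X P
  nonneg : 0 ≤ a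
  le : eLpNorm X p P ≤ ENNReal.ofReal a

namespace LpBound

variable {X Y : Ω → V} {p q r : ℝ≥0∞} {a b : ℝ}

theorem memLp (h : LpBound X p P a) : MemLp X p P :=
  ⟨h.meas, h.le.trans_lt ENNReal.ofReal_lt_top⟩

theorem mono (h : LpBound X p P a) (hab : a ≤ b) : LpBound X p P b :=
  ⟨h.meas, h.nonneg.trans hab, h.le.trans (ENNReal.ofReal_le_ofReal hab)⟩

theorem mono_exponent [IsProbabilityMeasure P] (h : LpBound X q P a) (hpq : p ≤ q) :
    LpBound X p P a :=
  ⟨h.meas, h.nonneg, (eLpNorm_le_eLpNorm_of_exponent_le hpq h.meas).trans h.le⟩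

theorem add (hX : LpBound X p P a) (hY : LpBound Y p P b) (hp : 1 ≤ p) :
    LpBound (fun ω => X ω + Y ω) p P (a + b) :=
  ⟨hX.meas.add hY.meas, add_nonneg hX.nonneg hY.nonneg,
    (eLpNorm_add_le hX.meas hY.meas hp).trans (by
      rw [ENNReal.ofReal_add hX.nonneg hY.nonneg]
      exact add_le_add hX.le hY.le)⟩

theorem sub (hX : LpBound X p P a) (hY : LpBound Y p P b) (hp : 1 ≤ p) :
    LpBound (fun ω => X ω - Y ω) p P (a + b) :=
  ⟨hX.meas.sub hY.meas, add_nonneg hX.nonneg hY.nonneg,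
    (eLpNorm_sub_le hX.meas hY.meas hp).trans (by
      rw [ENNReal.ofReal_add hX.nonneg hY.nonneg]
      exact add_le_add hX.le hY.le)⟩

theorem const_smul [NormedSpace ℝ V] (hX : LpBound X p P a) (c : ℝ) :
    LpBound (fun ω => c • X ω) p P (|c| * a) :=
  ⟨hX.meas.const_smul c, mul_nonneg (abs_nonneg _) hX.nonneg, by
    have h := eLpNorm_const_smul c X p P
    rw [show (fun ω => c • X ω) = c • X from rfl, h, ENNReal.ofReal_mul (abs_nonneg _),
      ← Real.norm_eq_abs, ofReal_norm]
    gcongr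
    exact hX.le⟩

theorem sum {ι : Type*} {s : Finset ι} {X : ι → Ω → V} {c : ι → ℝ}
    (h : ∀ i ∈ s, LpBound (X i) p P (c i)) (hp : 1 ≤ p) :
    LpBound (fun ω => ∑ i ∈ s, X i ω) p P (∑ i ∈ s, c i) := by
  classical
  induction s using Finset.induction_on with
  | empty => exact ⟨by simpa using aestronglyMeasurable_const, by simp, by simp⟩
  | insert i s hi ih =>
    have h1 := (h i (Finset.mem_insert_self _ _)).add
      (ih fun j hj => h j (Finset.mem_insert_of_mem hj)) hp
    simpa only [Finset.sum_insert hi] using h1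

theorem norm (h : LpBound X p P a) : LpBound (fun ω => ‖X ω‖) p P a :=
  ⟨h.meas.norm, h.nonneg, by rw [eLpNorm_norm]; exact h.le⟩

theorem of_norm_le {G : Ω → ℝ} (h : LpBound G p P a) (hX : AEStronglyMeasurable X P)
    (hXG : ∀ ω, ‖X ω‖ ≤ G ω) : LpBound X p P a :=
  ⟨hX, h.nonneg, (eLpNorm_mono_real hXG).trans h.le⟩

theorem mul {F G : Ω → ℝ} [hpqr : ENNReal.HolderTriple p q r] (hF : LpBound F p P a)
    (hG : LpBound G q P b) : LpBound (fun ω => F ω * G ω) r P (a * b) :=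
  ⟨hF.meas.mul hG.meas, mul_nonneg hF.nonneg hG.nonneg, by
    rw [ENNReal.ofReal_mul hF.nonneg]
    exact (eLpNorm_smul_le_mul_eLpNorm (r := r) hG.meas hF.meas).trans
      (mul_le_mul' hF.le hG.le)⟩

theorem const_mul {F : Ω → ℝ} (hF : LpBound F p P a) (c : ℝ) :
    LpBound (fun ω => c * F ω) p P (|c| * a) := hF.const_smul c

theorem holderTriple_four_four_two : ENNReal.HolderTriple 4 4 2 := by
  refine ⟨?_⟩
  rw [← two_mul, show (4 : ℝ≥0∞) = 2 * 2 by norm_num,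
    ENNReal.mul_inv (by norm_num) (by norm_num), ← mul_assoc,
    ENNReal.mul_inv_cancel (by norm_num) (by norm_num), one_mul]

theorem holderTriple_six_six_three : ENNReal.HolderTriple 6 6 3 := by
  refine ⟨?_⟩
  rw [← two_mul, show (6 : ℝ≥0∞) = 2 * 3 by norm_num,
    ENNReal.mul_inv (by norm_num) (by norm_num), ← mul_assoc,
    ENNReal.mul_inv_cancel (by norm_num) (by norm_num), one_mul]

theorem holderTriple_three_six_two : ENNReal.HolderTriple 3 6 2 := by
  refine ⟨?_⟩
  have h3 : (3 : ℝ≥0∞)⁻¹ = 2 * 6⁻¹ := by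
    rw [show (6 : ℝ≥0∞) = 2 * 3 by norm_num,
      ENNReal.mul_inv (by norm_num) (by norm_num), ← mul_assoc,
      ENNReal.mul_inv_cancel (by norm_num) (by norm_num), one_mul]
  have h2 : (2 : ℝ≥0∞)⁻¹ = 3 * 6⁻¹ := by
    rw [show (6 : ℝ≥0∞) = 3 * 2 by norm_num,
      ENNReal.mul_inv (by norm_num) (by norm_num), ← mul_assoc,
      ENNReal.mul_inv_cancel (by norm_num) (by norm_num), one_mul]
  rw [h3, h2]
  ring

theorem mul_four {F G : Ω → ℝ} (hF : LpBound F 4 P a) (hG : LpBound G 4 P b) :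
    LpBound (fun ω => F ω * G ω) 2 P (a * b) :=
  have := holderTriple_four_four_two
  hF.mul hG

/-- The exponents are `1/6 + 1/6 = 1/3` and `1/3 + 1/6 = 1/2`. This is where order 6 is needed: the
cubic Taylor remainder must be in L². -/
theorem cube {F : Ω → ℝ} (hF : LpBound F 6 P a) : LpBound (fun ω => F ω ^ 3) 2 P (a ^ 3) := by
  have := holderTriple_six_six_three
  have := holderTriple_three_six_two
  have h : LpBound (fun ω => F ω * F ω * F ω) 2 P (a * a * a) := (hF.mul (r := 3) hF).mul hF
  simpa only [pow_succ, pow_zero, one_mul] using h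

theorem lintegral_le {p : ℕ} (h : LpBound X p P a) (hp : p ≠ 0) :
    ∫⁻ ω, ‖X ω‖ₑ ^ p ∂P ≤ ENNReal.ofReal (a ^ p) := by
  rw [← eLpNorm_natCast_pow X hp, ENNReal.ofReal_pow h.nonneg]
  exact pow_le_pow_left' h.le p

theorem of_lintegral_le {p : ℕ} (hX : AEStronglyMeasurable X P) (ha : 0 ≤ a) (hp : p ≠ 0)
    (h : ∫⁻ ω, ‖X ω‖ₑ ^ p ∂P ≤ ENNReal.ofReal (a ^ p)) : LpBound X p P a := by
  refine ⟨hX, ha, ?_⟩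
  rw [← eLpNorm_natCast_pow X hp, ENNReal.ofReal_pow ha] at h
  exact (ENNReal.pow_le_pow_left_iff hp).mp h

theorem integral_sq_le (h : LpBound X 2 P a) : ∫ ω, ‖X ω‖ ^ 2 ∂P ≤ a ^ 2 := by
  have h1 : LpBound X ((2 : ℕ) : ℝ≥0∞) P a := by simpa using h
  have h2 := h1.lintegral_le two_ne_zero
  rw [integral_eq_lintegral_of_nonneg_ae (ae_of_all _ fun _ => by positivity) (by exact h.meas.norm.pow 2)]
  refine ENNReal.toReal_le_of_le_ofReal (by positivity) ?_
  simpa [ENNReal.ofReal_pow, ofReal_norm] using h2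

theorem of_integral_sq_le (h : MemLp X 2 P) (ha : 0 ≤ a) (hle : ∫ ω, ‖X ω‖ ^ 2 ∂P ≤ a ^ 2) :
    LpBound X 2 P a := by
  have key : LpBound X ((2 : ℕ) : ℝ≥0∞) P a := by
    refine of_lintegral_le h.1 ha two_ne_zero ?_
    have h2 := (memLp_two_iff_integrable_sq_norm h.1).mp h
    have h3 := ofReal_integral_eq_lintegral_ofReal h2 (ae_of_all _ fun _ => by positivity)
    simp only [ENNReal.ofReal_pow (norm_nonneg _), ofReal_norm] at h3
    rw [← h3]
    exact ENNReal.ofReal_le_ofReal hle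
  simpa using key

end LpBound

end LpBound

/-! ### Orthogonal increments in L² -/

section Orthogonality

variable {Ω V : Type*} [MeasurableSpace Ω] [NormedAddCommGroup V] [InnerProductSpace ℝ V]
  {P : Measure Ω}

theorem integrable_inner_of_memLp_two {X Y : Ω → V} (hX : MemLp X 2 P) (hY : MemLp Y 2 P) :
    Integrable (fun ω => inner ℝ (X ω) (Y ω)) P := by
  have h2 : Integrable (fun ω => ‖X ω‖ * ‖Y ω‖) P := hX.norm.integrable_mul hY.norm
  exact h2.mono (hX.1.inner hY.1) (ae_of_all _ fun ω => by
    simpa using norm_inner_le_norm (𝕜 := ℝ) (X ω) (Y ω))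

/-- The square-root growth in `L²` of sums whose increments are orthogonal to the past. -/
theorem LpBound.sum_of_orthogonal {m : ℕ → Ω → V} {b : ℝ} (hm : ∀ k, LpBound (m k) 2 P b)
    (horth : ∀ k, ∫ ω, inner ℝ (∑ i ∈ Finset.range k, m i ω) (m k ω) ∂P = 0) (N : ℕ) :
    LpBound (fun ω => ∑ i ∈ Finset.range N, m i ω) 2 P (√N * b) := by
  have hb : 0 ≤ b := (hm 0).nonneg
  have hmem : ∀ k, MemLp (fun ω => ∑ i ∈ Finset.range k, m i ω) 2 P := fun k =>
    memLp_finsetSum _ fun i _ => (hm i).memLp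
  refine LpBound.of_integral_sq_le (hmem N) (by positivity) ?_
  rw [mul_pow, Real.sq_sqrt (Nat.cast_nonneg N)]
  induction N with
  | zero => simp
  | succ k ih =>
    have h1 : ∀ ω, ‖∑ i ∈ Finset.range (k + 1), m i ω‖ ^ 2
        = ‖∑ i ∈ Finset.range k, m i ω‖ ^ 2
          + 2 * inner ℝ (∑ i ∈ Finset.range k, m i ω) (m k ω) + ‖m k ω‖ ^ 2 := fun ω => by
      rw [Finset.sum_range_succ, norm_add_sq_real]
    have i1 := (memLp_two_iff_integrable_sq_norm (hmem k).1).mp (hmem k)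
    have i2 := (integrable_inner_of_memLp_two (hmem k) (hm k).memLp).const_mul 2
    have i3 := (memLp_two_iff_integrable_sq_norm (hm k).meas).mp (hm k).memLp
    simp_rw [h1]
    have e1 := integral_add (i1.add i2) i3
    have e2 := integral_add i1 i2
    simp only [Pi.add_apply] at e1
    rw [e1, e2, integral_const_mul, horth k]
    have := (hm k).integral_sq_le
    push_cast
    linarith

end Orthogonality

/-! ### Fubini for a fresh noise variable -/

section Independence

variable {Ω α Z : Type*} [MeasurableSpace Ω] [MeasurableSpace α] [MeasurableSpace Z]
  {P : Measure Ω} [IsProbabilityMeasure P] {Pξ : Measure Z} [IsProbabilityMeasure Pξ]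
  {U : Ω → α} {ζ : Ω → Z}

theorem lintegral_of_indepFun (hind : IndepFun U ζ P) (hU : Measurable U) (hζ : Measurable ζ)
    (hlaw : P.map ζ = Pξ) {W : α → Z → ℝ≥0∞} (hW : Measurable (Function.uncurry W)) :
    ∫⁻ ω, W (U ω) (ζ ω) ∂P = ∫⁻ ω, ∫⁻ z, W (U ω) z ∂Pξ ∂P := by
  have hmap := (indepFun_iff_map_prod_eq_prod_map_map hU.aemeasurable hζ.aemeasurable).mp hind
  rw [hlaw] at hmap
  have hPU : IsProbabilityMeasure (P.map U) := Measure.isProbabilityMeasure_map hU.aemeasurable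
  calc ∫⁻ ω, W (U ω) (ζ ω) ∂P
      = ∫⁻ x, Function.uncurry W x ∂(P.map fun ω => (U ω, ζ ω)) := by
        rw [lintegral_map hW (hU.prodMk hζ)]; rfl
    _ = ∫⁻ u, ∫⁻ z, W u z ∂Pξ ∂(P.map U) := by
        rw [hmap, lintegral_prod _ hW.aemeasurable]; rfl
    _ = _ := by
        rw [lintegral_map (f := fun u => ∫⁻ z, W u z ∂Pξ) hW.lintegral_prod_right' hU]

/-- Freezing `(S, U)` and integrating the noise first kills the inner product, since `M u` is
centred for every `u`. `S` and `U` must be jointly independent of `ζ`, because both are functions of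
the past. -/
theorem integral_inner_eq_zero_of_indepFun {d : ℕ} {S : Ω → E d}
    (hind : IndepFun (fun ω => (S ω, U ω)) ζ P) (hS : Measurable S) (hU : Measurable U)
    (hζ : Measurable ζ) (hlaw : P.map ζ = Pξ) {M : α → Z → E d}
    (hM : Measurable (Function.uncurry M)) (hMint : ∀ u, Integrable (M u) Pξ)
    (hMzero : ∀ u, ∫ z, M u z ∂Pξ = 0) (hS2 : MemLp S 2 P)
    (hM2 : MemLp (fun ω => M (U ω) (ζ ω)) 2 P) :
    ∫ ω, inner ℝ (S ω) (M (U ω) (ζ ω)) ∂P = 0 := by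
  have hSU : Measurable fun ω => (S ω, U ω) := hS.prodMk hU
  have hmap := (indepFun_iff_map_prod_eq_prod_map_map hSU.aemeasurable hζ.aemeasurable).mp hind
  rw [hlaw] at hmap
  have hPU : IsProbabilityMeasure (P.map fun ω => (S ω, U ω)) :=
    Measure.isProbabilityMeasure_map hSU.aemeasurable
  have hWm : Measurable fun x : (E d × α) × Z => (inner ℝ x.1.1 (M x.1.2 x.2) : ℝ) := by
    have h2 : Measurable fun x : (E d × α) × Z => M x.1.2 x.2 :=
      hM.comp (measurable_fst.snd.prodMk measurable_snd)
    exact measurable_fst.fst.inner h2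
  have hint : Integrable (fun x : (E d × α) × Z => (inner ℝ x.1.1 (M x.1.2 x.2) : ℝ))
      ((P.map fun ω => (S ω, U ω)).prod Pξ) := by
    rw [← hmap]
    exact (integrable_map_measure hWm.aestronglyMeasurable (hSU.prodMk hζ).aemeasurable).mpr
      (integrable_inner_of_memLp_two hS2 hM2)
  calc ∫ ω, inner ℝ (S ω) (M (U ω) (ζ ω)) ∂P
      = ∫ x, (inner ℝ x.1.1 (M x.1.2 x.2) : ℝ) ∂(P.map fun ω => ((S ω, U ω), ζ ω)) := by
        rw [integral_map (hSU.prodMk hζ).aemeasurable hWm.aestronglyMeasurable]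
    _ = ∫ x : E d × α, ∫ z, (inner ℝ x.1 (M x.2 z) : ℝ) ∂Pξ ∂(P.map fun ω => (S ω, U ω)) := by
        rw [hmap, integral_prod _ hint]
    _ = 0 := by
        have : ∀ x : E d × α, ∫ z, (inner ℝ x.1 (M x.2 z) : ℝ) ∂Pξ = 0 := fun x => by
          rw [integral_inner (hMint x.2), hMzero, inner_zero_right]
        simp [this]

end Independence

/-! ### The filtration of the driving noise -/

section Past

variable {Ω S Z : Type*} [MeasurableSpace S] [MeasurableSpace Z] {θ₀ : Ω → S} {ξ : ℕ → Ω → Z}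

/-- The starting point together with `ξ 0, …, ξ k`. -/
def history (θ₀ : Ω → S) (ξ : ℕ → Ω → Z) (k : ℕ) (ω : Ω) : S × (Finset.range (k + 1) → Z) :=
  (θ₀ ω, fun i => ξ i ω)

/-- The `σ`-algebra generated by the starting point and `ξ 0, …, ξ k`. -/
abbrev past (θ₀ : Ω → S) (ξ : ℕ → Ω → Z) (k : ℕ) : MeasurableSpace Ω :=
  MeasurableSpace.comap (history θ₀ ξ k) inferInstance

theorem measurable_past_start (k : ℕ) : Measurable[past θ₀ ξ k] θ₀ :=
  measurable_fst.comp (comap_measurable (history θ₀ ξ k))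

theorem measurable_past_noise {i k : ℕ} (hik : i ≤ k) : Measurable[past θ₀ ξ k] (ξ i) :=
  (measurable_pi_apply (⟨i, by simp; omega⟩ : Finset.range (k + 1))).comp
    (measurable_snd.comp (comap_measurable (history θ₀ ξ k)))

theorem past_mono {k l : ℕ} (hkl : k ≤ l) : past θ₀ ξ k ≤ past θ₀ ξ l := by
  have : Measurable[past θ₀ ξ l] (history θ₀ ξ k) :=
    (measurable_past_start l).prodMk (@measurable_pi_lambda _ _ _ (past θ₀ ξ l) _ _ fun i =>
      measurable_past_noise ((Nat.lt_succ_iff.mp (Finset.mem_range.mp i.2)).trans hkl))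
  exact this.comap_le

variable [MeasurableSpace Ω] {P : Measure Ω} [IsProbabilityMeasure P]

theorem measurable_history (hθ : Measurable θ₀) (hξ : ∀ k, Measurable (ξ k)) (k : ℕ) :
    Measurable (history θ₀ ξ k) :=
  hθ.prodMk (measurable_pi_lambda _ fun i => hξ i)

theorem past_le (hθ : Measurable θ₀) (hξ : ∀ k, Measurable (ξ k)) (k : ℕ) :
    past θ₀ ξ k ≤ ‹MeasurableSpace Ω› :=
  (measurable_history hθ hξ k).comap_le

/-- Start, earlier noise and next noise have a product joint law: `θ₀` is independent of the whole
sequence, and the sequence is mutually independent. Reassociating the triple product gives the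
claim. -/
theorem indepFun_history (hθ : Measurable θ₀) (hξ : ∀ k, Measurable (ξ k))
    (hi : iIndepFun ξ P) (h0 : IndepFun θ₀ (fun ω k => ξ k ω) P) (k : ℕ) :
    IndepFun (history θ₀ ξ k) (ξ (k + 1)) P := by
  set Y : Ω → (Finset.range (k + 1) → Z) := fun ω i => ξ i ω with hY
  have hYm : Measurable Y := measurable_pi_lambda _ fun i => hξ i
  have h1 : IndepFun Y (ξ (k + 1)) P := by
    have := hi.indepFun_finset (Finset.range (k + 1)) {k + 1} (by simp) hξ
    exact this.comp measurable_id
      (measurable_pi_apply (⟨k + 1, by simp⟩ : ({k + 1} : Finset ℕ)))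
  have h2 : IndepFun θ₀ (fun ω => (Y ω, ξ (k + 1) ω)) P := by
    have hφ : Measurable fun x : ℕ → Z =>
        ((fun i => x i : Finset.range (k + 1) → Z), x (k + 1)) :=
      (measurable_pi_lambda _ fun i => measurable_pi_apply _).prodMk (measurable_pi_apply _)
    exact h0.comp measurable_id hφ
  have e1 := (indepFun_iff_map_prod_eq_prod_map_map hYm.aemeasurable
    (hξ (k + 1)).aemeasurable).mp h1
  have e2 := (indepFun_iff_map_prod_eq_prod_map_map hθ.aemeasurable
    (hYm.prodMk (hξ (k + 1))).aemeasurable).mp h2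
  have h3 : IndepFun θ₀ Y P := h2.comp measurable_id measurable_fst
  have e3 := (indepFun_iff_map_prod_eq_prod_map_map hθ.aemeasurable hYm.aemeasurable).mp h3
  refine (indepFun_iff_map_prod_eq_prod_map_map (measurable_history hθ hξ k).aemeasurable
    (hξ (k + 1)).aemeasurable).mpr ?_
  have i1 := Measure.isProbabilityMeasure_map (μ := P) hθ.aemeasurable
  have i2 := Measure.isProbabilityMeasure_map (μ := P) hYm.aemeasurable
  have i3 := Measure.isProbabilityMeasure_map (μ := P) (hξ (k + 1)).aemeasurable
  have e4 : P.map (history θ₀ ξ k) = (P.map θ₀).prod (P.map Y) := e3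
  rw [e4]
  have e5 : P.map (fun ω => (history θ₀ ξ k ω, ξ (k + 1) ω))
      = (P.map fun ω => (θ₀ ω, (Y ω, ξ (k + 1) ω))).map MeasurableEquiv.prodAssoc.symm := by
    rw [Measure.map_map MeasurableEquiv.prodAssoc.symm.measurable
      (hθ.prodMk (hYm.prodMk (hξ (k + 1))))]
    rfl
  rw [e5, e2, e1]
  exact ((MeasurePreserving.symm _
    (measurePreserving_prodAssoc (P.map θ₀) (P.map Y) (P.map (ξ (k + 1)))))).map_eq

theorem indepFun_of_measurable_past {α : Type*} [MeasurableSpace α] (hθ : Measurable θ₀)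
    (hξ : ∀ k, Measurable (ξ k)) (hi : iIndepFun ξ P) (h0 : IndepFun θ₀ (fun ω k => ξ k ω) P)
    {k : ℕ} {U : Ω → α} (hU : Measurable[past θ₀ ξ k] U) : IndepFun U (ξ (k + 1)) P :=
  (IndepFun_iff_Indep _ _ _).mpr
    (indep_of_indep_of_le_left
      ((IndepFun_iff_Indep _ _ _).mp (indepFun_history hθ hξ hi h0 k)) hU.comap_le)

end Past

/-! ### Consequences of co-coercivity for one step -/

section Noise

variable {d : ℕ} {Z : Type*} [MeasurableSpace Z] {Pξ : Measure Z}
  {f : E d → ℝ} {gradF : E d → Z → E d} {θs : E d} {μ L L₁ L₂ L₃ L₄ τ : ℝ}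

theorem NoiseAssumption.measurable_comp (hn : NoiseAssumption f gradF Pξ θs 6 L₁ τ) {Ω : Type*}
    {mΩ : MeasurableSpace Ω} {X : Ω → E d} {ζ : Ω → Z} (hX : Measurable X) (hζ : Measurable ζ) :
    Measurable fun ω => gradF (X ω) (ζ ω) :=
  hn.measurable.comp (hX.prodMk hζ)

theorem NoiseAssumption.measurable_apply (hn : NoiseAssumption f gradF Pξ θs 6 L₁ τ) (θ : E d) :
    Measurable (gradF θ) :=
  hn.measurable_comp measurable_const measurable_id

theorem LpBound.comp_law {V : Type*} [NormedAddCommGroup V] {Ω : Type*}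
    [MeasurableSpace Ω] {P : Measure Ω} {ζ : Ω → Z} {g : Z → V} {p : ℝ≥0∞} {a : ℝ}
    (hg : LpBound g p Pξ a) (hζ : Measurable ζ) (hlaw : P.map ζ = Pξ) :
    LpBound (fun ω => g (ζ ω)) p P a := by
  have hm : AEStronglyMeasurable g (P.map ζ) := hlaw ▸ hg.meas
  refine ⟨hm.comp_measurable hζ, hg.nonneg, ?_⟩
  have := eLpNorm_map_measure (p := p) hm hζ.aemeasurable
  rw [hlaw] at this
  exact this.symm.trans_le hg.le

/-- Co-coercivity of order `q` combined with the Lipschitz gradient makes `gradF` Lipschitz from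
points to L^q, with the same constant `L` for every `q`. -/
theorem NoiseAssumption.lpBound_sub (hn : NoiseAssumption f gradF Pξ θs 6 L₁ τ)
    (hs : Smooth f L₂ L₃ L₄) (h₁ : L₁ ≤ L) (h₂ : L₂ ≤ L) {q : ℕ} (hq2 : 2 ≤ q) (hq6 : q ≤ 6)
    (x y : E d) : LpBound (fun z => gradF x z - gradF y z) q Pξ (L * ‖x - y‖) := by
  have hL : 0 ≤ L := hn.pos.le.trans h₁
  refine LpBound.of_lintegral_le
    ((hn.measurable_apply x).sub (hn.measurable_apply y)).aestronglyMeasurable (by positivity)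
    (by omega) ((hn.cocoercive q hq2 hq6 x y).trans (ENNReal.ofReal_le_ofReal ?_))
  have h1 : inner ℝ (gradient f x - gradient f y) (x - y) ≤ L * ‖x - y‖ * ‖x - y‖ :=
    (real_inner_le_norm _ _).trans (by
      gcongr
      exact (hs.lipschitz x y).trans (by gcongr))
  have h0 := hn.pos.le
  obtain ⟨p, rfl⟩ : ∃ p, q = p + 2 := ⟨q - 2, by omega⟩
  calc L₁ ^ (p + 2 - 1) * ‖x - y‖ ^ (p + 2 - 2) * inner ℝ (gradient f x - gradient f y) (x - y)
      ≤ L₁ ^ (p + 2 - 1) * ‖x - y‖ ^ (p + 2 - 2) * (L * ‖x - y‖ * ‖x - y‖) := by gcongr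
    _ ≤ L ^ (p + 2 - 1) * ‖x - y‖ ^ (p + 2 - 2) * (L * ‖x - y‖ * ‖x - y‖) := by gcongr
    _ = (L * ‖x - y‖) ^ (p + 2) := by
      rw [show p + 2 - 1 = p + 1 by omega, show p + 2 - 2 = p by omega]; ring

theorem NoiseAssumption.lpBound_star (hn : NoiseAssumption f gradF Pξ θs 6 L₁ τ) :
    LpBound (gradF θs) 6 Pξ τ :=
  ⟨(hn.measurable_apply θs).aestronglyMeasurable, hn.moment.1, by simpa using hn.moment.2⟩

variable [IsProbabilityMeasure Pξ]

theorem NoiseAssumption.memLp_two (hn : NoiseAssumption f gradF Pξ θs 6 L₁ τ)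
    (hs : Smooth f L₂ L₃ L₄) (θ : E d) : MemLp (gradF θ) 2 Pξ := by
  have h1 := (hn.lpBound_sub hs (le_max_left L₁ L₂) (le_max_right L₁ L₂) le_rfl (by norm_num)
    θ θs).memLp
  have h2 := (hn.lpBound_star.mono_exponent (p := 2) (by norm_num)).memLp
  have h3 := MemLp.add (by simpa using h1) h2
  refine h3.congr_norm (hn.measurable_apply θ).aestronglyMeasurable (ae_of_all _ fun z => ?_)
  simp

theorem NoiseAssumption.integrable (hn : NoiseAssumption f gradF Pξ θs 6 L₁ τ)
    (hs : Smooth f L₂ L₃ L₄) (θ : E d) : Integrable (gradF θ) Pξ :=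
  (hn.memLp_two hs θ).integrable (by norm_num)

/-- One step of SGD with a common noise contracts in mean square. -/
theorem NoiseAssumption.contraction (hn : NoiseAssumption f gradF Pξ θs 6 L₁ τ)
    (hs : Smooth f L₂ L₃ L₄) (hc : StronglyConvex f μ) {η : ℝ} (hη : 0 ≤ η) (hηL : η * L₁ ≤ 1)
    (x y : E d) :
    ∫⁻ z, ‖(x - η • gradF x z) - (y - η • gradF y z)‖ₑ ^ 2 ∂Pξ
      ≤ ENNReal.ofReal ((1 - η * μ) * ‖x - y‖ ^ 2) := by
  set D : Z → E d := fun z => gradF x z - gradF y z with hD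
  have hD2 : MemLp D 2 Pξ := (hn.memLp_two hs x).sub (hn.memLp_two hs y)
  have hDint : ∫ z, D z ∂Pξ = gradient f x - gradient f y := by
    rw [integral_sub (hn.integrable hs x) (hn.integrable hs y), hn.unbiased, hn.unbiased]
  set t : ℝ := inner ℝ (gradient f x - gradient f y) (x - y) with ht
  have hmon : μ * ‖x - y‖ ^ 2 ≤ t := hc.monotone x y
  have ht0 : 0 ≤ t := le_trans (by have := hc.pos; positivity) hmon
  have hsq := (memLp_two_iff_integrable_sq_norm hD2.1).mp hD2
  have hDsq : ∫ z, ‖D z‖ ^ 2 ∂Pξ ≤ L₁ * t := by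
    have h1 := hn.cocoercive 2 le_rfl (by norm_num) x y
    rw [integral_eq_lintegral_of_nonneg_ae (ae_of_all _ fun _ => by positivity)
      (by exact hD2.1.norm.pow 2)]
    refine ENNReal.toReal_le_of_le_ofReal (mul_nonneg hn.pos.le ht0) ?_
    simpa [ENNReal.ofReal_pow, ofReal_norm] using h1
  have hexp : ∀ z, ‖(x - η • gradF x z) - (y - η • gradF y z)‖ ^ 2
      = ‖x - y‖ ^ 2 - 2 * η * inner ℝ (x - y) (D z) + η ^ 2 * ‖D z‖ ^ 2 := fun z => by
    rw [show (x - η • gradF x z) - (y - η • gradF y z) = (x - y) - η • D z by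
      simp only [hD, smul_sub]; abel, norm_sub_sq_real, inner_smul_right, norm_smul, mul_pow,
      Real.norm_eq_abs, sq_abs]
    ring
  have hinner : Integrable (fun z => 2 * η * inner ℝ (x - y) (D z)) Pξ :=
    ((hD2.integrable (by norm_num)).const_inner (x - y)).const_mul _
  have hI : Integrable (fun z => ‖(x - η • gradF x z) - (y - η • gradF y z)‖ ^ 2) Pξ := by
    simp_rw [hexp]
    exact ((integrable_const _).sub hinner).add (hsq.const_mul _)
  have hval : ∫ z, ‖(x - η • gradF x z) - (y - η • gradF y z)‖ ^ 2 ∂Pξ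
      = ‖x - y‖ ^ 2 - 2 * η * t + η ^ 2 * ∫ z, ‖D z‖ ^ 2 ∂Pξ := by
    simp_rw [hexp]
    have e1 := integral_add ((integrable_const (‖x - y‖ ^ 2)).sub hinner) (hsq.const_mul (η ^ 2))
    have e2 := integral_sub (integrable_const (μ := Pξ) (‖x - y‖ ^ 2)) hinner
    simp only [Pi.sub_apply] at e1
    rw [e1, e2, integral_const_mul, integral_const_mul,
      integral_inner (hD2.integrable (by norm_num)), hDint, real_inner_comm, ← ht]
    simp
  have h3 := ofReal_integral_eq_lintegral_ofReal hI (ae_of_all _ fun _ => by positivity)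
  simp only [ENNReal.ofReal_pow (norm_nonneg _), ofReal_norm] at h3
  rw [← h3, hval]
  refine ENNReal.ofReal_le_ofReal ?_
  have h4 : η ^ 2 * ∫ z, ‖D z‖ ^ 2 ∂Pξ ≤ η ^ 2 * (L₁ * t) := by gcongr
  -- Of the gain `2 η t`, one half absorbs `η² L₁ t`; the other half, by strong monotonicity, yields
  -- the contraction.
  have h5 : η * t * (η * L₁) ≤ η * t * 1 := by gcongr
  have h6 : η * (μ * ‖x - y‖ ^ 2) ≤ η * t := by gcongr
  nlinarith

theorem trace_noiseCov_eq (hn : NoiseAssumption f gradF Pξ θs 6 L₁ τ) :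
    (noiseCov gradF Pξ θs).trace = ∫ z, ‖gradF θs z‖ ^ 2 ∂Pξ := by
  have h2 : MemLp (gradF θs) 2 Pξ := (hn.lpBound_star.mono_exponent (p := 2) (by norm_num)).memLp
  have hi : ∀ i, Integrable (fun z => gradF θs z i * gradF θs z i) Pξ := fun i => by
    have h3 : MemLp (fun z => gradF θs z i) 2 Pξ := by
      refine MemLp.of_le h2 ?_ (ae_of_all _ fun z => PiLp.norm_apply_le (gradF θs z) i)
      exact ((EuclideanSpace.proj (𝕜 := ℝ) i).continuous.measurable.comp
        (hn.measurable_apply θs)).aestronglyMeasurable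
    exact h3.integrable_mul h3
  simp only [Matrix.trace, Matrix.diag, noiseCov, Matrix.of_apply]
  rw [← integral_finsetSum _ fun i _ => hi i]
  congr 1
  ext z
  rw [EuclideanSpace.norm_sq_eq]
  simp [sq]

/-- The source of the leading constant: the second moment of the noise at `θs` is exactly the trace
of its covariance. -/
theorem NoiseAssumption.lpBound_star_two (hn : NoiseAssumption f gradF Pξ θs 6 L₁ τ) :
    LpBound (gradF θs) 2 Pξ √(noiseCov gradF Pξ θs).trace := by
  have h0 : 0 ≤ (noiseCov gradF Pξ θs).trace := by
    rw [trace_noiseCov_eq hn]; positivity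
  refine LpBound.of_integral_sq_le (hn.lpBound_star.mono_exponent (p := 2) (by norm_num)).memLp
    (Real.sqrt_nonneg _) ?_
  rw [Real.sq_sqrt h0, trace_noiseCov_eq hn]

variable {Ω : Type*} [MeasurableSpace Ω] {P : Measure Ω} [IsProbabilityMeasure P]
  {X Y : Ω → E d} {ζ : Ω → Z}

theorem NoiseAssumption.lpBound_step (hn : NoiseAssumption f gradF Pξ θs 6 L₁ τ)
    (hs : Smooth f L₂ L₃ L₄) (hc : StronglyConvex f μ) {η b : ℝ} (hη : 0 ≤ η) (hηL : η * L₁ ≤ 1)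
    (hημ : η * μ ≤ 1) (hX : Measurable X) (hY : Measurable Y) (hζ : Measurable ζ)
    (hind : IndepFun (fun ω => (X ω, Y ω)) ζ P) (hlaw : P.map ζ = Pξ)
    (hb : LpBound (fun ω => X ω - Y ω) 2 P b) :
    LpBound (fun ω => (X ω - η • gradF (X ω) (ζ ω)) - (Y ω - η • gradF (Y ω) (ζ ω))) 2 P
      (√(1 - η * μ) * b) := by
  have hm : ∀ X : Ω → E d, Measurable X → Measurable fun ω => X ω - η • gradF (X ω) (ζ ω) :=
    fun X hX => hX.sub ((hn.measurable_comp hX hζ).const_smul η)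
  have hb' : LpBound (fun ω => X ω - Y ω) ((2 : ℕ) : ℝ≥0∞) P b := by simpa using hb
  have key : LpBound (fun ω => (X ω - η • gradF (X ω) (ζ ω)) - (Y ω - η • gradF (Y ω) (ζ ω)))
      ((2 : ℕ) : ℝ≥0∞) P (√(1 - η * μ) * b) := by
    refine LpBound.of_lintegral_le ((hm X hX).sub (hm Y hY)).aestronglyMeasurable
      (mul_nonneg (Real.sqrt_nonneg _) hb.nonneg) two_ne_zero ?_
    have hW : Measurable (Function.uncurry fun (u : E d × E d) (z : Z) =>
        ‖(u.1 - η • gradF u.1 z) - (u.2 - η • gradF u.2 z)‖ₑ ^ 2) := by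
      have hm' : ∀ g : (E d × E d) × Z → E d, Measurable g →
          Measurable fun w => g w - η • gradF (g w) w.2 := fun g hg =>
        hg.sub ((hn.measurable_comp hg measurable_snd).const_smul η)
      exact ((hm' _ measurable_fst.fst).sub (hm' _ measurable_fst.snd)).enorm.pow_const 2
    rw [lintegral_of_indepFun (W := fun u z =>
      ‖(u.1 - η • gradF u.1 z) - (u.2 - η • gradF u.2 z)‖ₑ ^ 2) hind (hX.prodMk hY) hζ hlaw hW]
    calc _ ≤ ∫⁻ ω, ENNReal.ofReal (1 - η * μ) * ‖X ω - Y ω‖ₑ ^ 2 ∂P := by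
          refine lintegral_mono fun ω => (hn.contraction hs hc hη hηL (X ω) (Y ω)).trans_eq ?_
          rw [ENNReal.ofReal_mul (by linarith), ENNReal.ofReal_pow (norm_nonneg _), ofReal_norm]
      _ = ENNReal.ofReal (1 - η * μ) * ∫⁻ ω, ‖X ω - Y ω‖ₑ ^ 2 ∂P :=
          lintegral_const_mul _ ((hX.sub hY).enorm.pow_const 2)
      _ ≤ ENNReal.ofReal (1 - η * μ) * ENNReal.ofReal (b ^ 2) := by
          gcongr
          exact hb'.lintegral_le two_ne_zero
      _ = _ := by
          rw [← ENNReal.ofReal_mul (by linarith), mul_pow, Real.sq_sqrt (by linarith)]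
  simpa using key

theorem NoiseAssumption.lpBound_sub_comp (hn : NoiseAssumption f gradF Pξ θs 6 L₁ τ)
    (hs : Smooth f L₂ L₃ L₄) (h₁ : L₁ ≤ L) (h₂ : L₂ ≤ L) {q : ℕ} (hq2 : 2 ≤ q) (hq6 : q ≤ 6)
    {a : ℝ} (hX : Measurable X) (hζ : Measurable ζ) (hind : IndepFun X ζ P) (hlaw : P.map ζ = Pξ)
    (ha : LpBound (fun ω => X ω - θs) q P a) :
    LpBound (fun ω => gradF (X ω) (ζ ω) - gradF θs (ζ ω)) q P (L * a) := by
  have hL : 0 ≤ L := hn.pos.le.trans h₁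
  have hq : q ≠ 0 := by omega
  refine LpBound.of_lintegral_le ((hn.measurable_comp hX hζ).sub
    (hn.measurable_comp measurable_const hζ)).aestronglyMeasurable (mul_nonneg hL ha.nonneg) hq ?_
  have hW : Measurable (Function.uncurry fun (u : E d) (z : Z) => ‖gradF u z - gradF θs z‖ₑ ^ q) :=
    ((hn.measurable_comp measurable_fst measurable_snd).sub
      (hn.measurable_comp measurable_const measurable_snd)).enorm.pow_const q
  rw [lintegral_of_indepFun (W := fun u z => ‖gradF u z - gradF θs z‖ₑ ^ q) hind hX hζ hlaw hW]
  calc _ ≤ ∫⁻ ω, ENNReal.ofReal (L ^ q) * ‖X ω - θs‖ₑ ^ q ∂P := by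
        refine lintegral_mono fun ω =>
          ((hn.lpBound_sub hs h₁ h₂ hq2 hq6 (X ω) θs).lintegral_le hq).trans_eq ?_
        rw [mul_pow, ENNReal.ofReal_mul (by positivity), ENNReal.ofReal_pow (norm_nonneg _),
          ofReal_norm]
    _ = ENNReal.ofReal (L ^ q) * ∫⁻ ω, ‖X ω - θs‖ₑ ^ q ∂P :=
        lintegral_const_mul _ ((hX.sub_const θs).enorm.pow_const q)
    _ ≤ ENNReal.ofReal (L ^ q) * ENNReal.ofReal (a ^ q) := by
        gcongr
        exact ha.lintegral_le hq
    _ = _ := by rw [← ENNReal.ofReal_mul (by positivity), mul_pow]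

end Noise

/-! ### Moment bounds along the chain -/

section Iterates

variable {d : ℕ} {Z : Type*} [MeasurableSpace Z] {Pξ : Measure Z}
  {f : E d → ℝ} {gradF : E d → Z → E d} {θs : E d} {μ L L₁ L₂ L₃ L₄ τ η : ℝ}
  {Ω S : Type*} [MeasurableSpace S] {θ₀ : Ω → S} {ξ : ℕ → Ω → Z}

theorem NoiseAssumption.measurable_sgd (hn : NoiseAssumption f gradF Pξ θs 6 L₁ τ) {s : Ω → E d}
    (hs0 : Measurable[past θ₀ ξ 0] s) (k : ℕ) :
    Measurable[past θ₀ ξ k] (sgd gradF η s ξ k) := by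
  induction k with
  | zero => exact hs0
  | succ k ih =>
    have h1 : Measurable[past θ₀ ξ (k + 1)] (sgd gradF η s ξ k) :=
      ih.mono (past_mono k.le_succ) le_rfl
    exact h1.sub ((hn.measurable_comp h1 (measurable_past_noise le_rfl)).const_smul η)

variable [MeasurableSpace Ω] {P : Measure Ω}

/-- Standing assumptions on the driving randomness, with honest measurability. -/
structure Driven (P : Measure Ω) (Pξ : Measure Z) (θ₀ : Ω → S) (ξ : ℕ → Ω → Z) : Prop where
  measurable_start : Measurable θ₀
  measurable_noise : ∀ k, Measurable (ξ k)
  law : ∀ k, P.map (ξ k) = Pξ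
  iIndep : iIndepFun ξ P
  indep : IndepFun θ₀ (fun ω k => ξ k ω) P

theorem Driven.measurable {α : Type*} [MeasurableSpace α] (h : Driven P Pξ θ₀ ξ) {k : ℕ}
    {U : Ω → α} (hU : Measurable[past θ₀ ξ k] U) : Measurable U :=
  hU.mono (past_le h.measurable_start h.measurable_noise k) le_rfl

variable [IsProbabilityMeasure P]

theorem Driven.indepFun {α : Type*} [MeasurableSpace α] (h : Driven P Pξ θ₀ ξ) {k : ℕ}
    {U : Ω → α} (hU : Measurable[past θ₀ ξ k] U) : IndepFun U (ξ (k + 1)) P :=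
  indepFun_of_measurable_past h.measurable_start h.measurable_noise h.iIndep h.indep hU

/-- Transfers the moment condition, which is stated for laws, to the iterates as random variables.
-/
theorem Driven.map_sgd (h : Driven P Pξ θ₀ ξ) (hn : NoiseAssumption f gradF Pξ θs 6 L₁ τ)
    {s : Ω → E d} (hs0 : Measurable[past θ₀ ξ 0] s) (k : ℕ) :
    P.map (sgd gradF η s ξ k) = iterLaw gradF Pξ η (P.map s) k := by
  induction k with
  | zero => rfl
  | succ k ih =>
    have h1 := hn.measurable_sgd (η := η) hs0 k
    have h2 := h.measurable h1
    have hmap := (indepFun_iff_map_prod_eq_prod_map_map h2.aemeasurable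
      (h.measurable_noise (k + 1)).aemeasurable).mp (h.indepFun h1)
    have hφ : Measurable fun x : E d × Z => x.1 - η • gradF x.1 x.2 :=
      measurable_fst.sub ((hn.measurable_comp measurable_fst measurable_snd).const_smul η)
    rw [iterLaw, Function.iterate_succ_apply', ← iterLaw, ← ih, stepLaw, ← h.law (k + 1), ← hmap,
      Measure.map_map hφ (h2.prodMk (h.measurable_noise (k + 1)))]
    rfl

/-- Starting from the Dirac mass at `θs` makes the geometric term of the moment condition vanish,
leaving a bound uniform in `k`. -/
theorem Driven.lpBound_sgd_star_six (h : Driven P Pξ θ₀ ξ)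
    (hn : NoiseAssumption f gradF Pξ θs 6 L₁ τ) {D c : ℝ}
    (hm : MomentCondition gradF Pξ θs 6 μ L τ D c) (hη : 0 < η) (hηL : η ≤ 1 / (L * c))
    (hμ : 0 < μ) (k : ℕ) :
    LpBound (fun ω => sgd gradF η (fun _ => θs) ξ k ω - θs) 6 P √(D * η * τ ^ 2 / μ) := by
  have h1 := h.measurable (hn.measurable_sgd (θ₀ := θ₀) (ξ := ξ) (η := η) (s := fun _ => θs)
    measurable_const k)
  have hD := hm.two_le_D
  have hpos : 0 ≤ D * η * τ ^ 2 / μ := by positivity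
  have h2 := hm.iterate η hη hηL (Measure.dirac θs) inferInstance k
  have hmap := h.map_sgd (η := η) hn (s := fun _ => θs) measurable_const k
  rw [Measure.map_const, measure_univ, one_smul] at hmap
  rw [← hmap] at h2
  have hm6 : Measurable fun θ : E d => ‖θ - θs‖ₑ ^ 6 :=
    (measurable_id.sub_const θs).enorm.pow_const 6
  simp only [sqMoment] at h2
  rw [lintegral_map hm6 h1, lintegral_dirac' _ hm6, sub_self, enorm_zero, zero_pow (by norm_num),
    ENNReal.zero_rpow_of_pos (by norm_num), mul_zero, zero_add] at h2
  have key : LpBound (fun ω => sgd gradF η (fun _ => θs) ξ k ω - θs) ((6 : ℕ) : ℝ≥0∞) P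
      √(D * η * τ ^ 2 / μ) := by
    refine LpBound.of_lintegral_le (h1.sub_const θs).aestronglyMeasurable (Real.sqrt_nonneg _)
      (by norm_num) ?_
    have h3 := ENNReal.rpow_le_rpow h2 (z := 3) (by norm_num)
    rw [← ENNReal.rpow_mul] at h3
    norm_num at h3
    refine h3.trans_eq ?_
    rw [show √(D * η * τ ^ 2 / μ) ^ 6 = (√(D * η * τ ^ 2 / μ) ^ 2) ^ 3 by ring,
      Real.sq_sqrt hpos, ENNReal.ofReal_pow hpos]
  simpa using key

variable [IsProbabilityMeasure Pξ]

theorem Driven.lpBound_sgd_sub (h : Driven P Pξ θ₀ ξ)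
    (hn : NoiseAssumption f gradF Pξ θs 6 L₁ τ)
    (hs : Smooth f L₂ L₃ L₄) (hc : StronglyConvex f μ) (hη : 0 ≤ η) (hηL : η * L₁ ≤ 1)
    (hημ : η * μ ≤ 1) {s t : Ω → E d} (hs0 : Measurable[past θ₀ ξ 0] s)
    (ht0 : Measurable[past θ₀ ξ 0] t) {b : ℝ} (hb : LpBound (fun ω => s ω - t ω) 2 P b) (k : ℕ) :
    LpBound (fun ω => sgd gradF η s ξ k ω - sgd gradF η t ξ k ω) 2 P (√(1 - η * μ) ^ k * b) := by
  induction k with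
  | zero => simpa [sgd] using hb
  | succ k ih =>
    have h1 := hn.measurable_sgd (η := η) hs0 k
    have h2 := hn.measurable_sgd (η := η) ht0 k
    have h3 := hn.lpBound_step hs hc hη hηL hημ (h.measurable h1) (h.measurable h2)
      (h.measurable_noise (k + 1)) (h.indepFun (h1.prodMk h2)) (h.law _) ih
    exact h3.mono (by rw [pow_succ]; exact le_of_eq (by ring))

theorem sqrt_one_sub_le {t : ℝ} (ht1 : t ≤ 1) : √(1 - t) ≤ 1 - t / 2 := by
  rw [Real.sqrt_le_left (by linarith)]
  nlinarith [sq_nonneg t]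

/-- Weaker than the L⁶ bound, as it does not shrink with `η`, but independent of the moment
condition. The value `2 τ / μ` is the fixed point of `a ↦ (1 - η μ / 2) a + η τ`. -/
theorem Driven.lpBound_sgd_star_two (h : Driven P Pξ θ₀ ξ)
    (hn : NoiseAssumption f gradF Pξ θs 6 L₁ τ)
    (hs : Smooth f L₂ L₃ L₄) (hc : StronglyConvex f μ) (hη : 0 ≤ η) (hηL : η * L₁ ≤ 1)
    (hημ : η * μ ≤ 1) (k : ℕ) :
    LpBound (fun ω => sgd gradF η (fun _ => θs) ξ k ω - θs) 2 P (2 * τ / μ) := by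
  have hμ := hc.pos
  have hτ := hn.moment.1
  induction k with
  | zero =>
    exact ⟨by simpa [sgd] using aestronglyMeasurable_const, by positivity, by simp [sgd]⟩
  | succ k ih =>
    have h1 := hn.measurable_sgd (θ₀ := θ₀) (ξ := ξ) (η := η) (s := fun _ => θs)
      measurable_const k
    -- The iterate is compared with one step from `θs` under the same noise; that step ends at `θs -
    -- η • gradF θs ξ`, and the defect is paid for by `h4`.
    have h3 := hn.lpBound_step hs hc hη hηL hημ (h.measurable h1) measurable_const
      (h.measurable_noise (k + 1)) (h.indepFun (h1.prodMk measurable_const)) (h.law _) ih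
    have h4 := ((hn.lpBound_star.mono_exponent (p := 2) (by norm_num)).comp_law
      (h.measurable_noise (k + 1)) (h.law _)).const_smul η
    have h5 := h3.sub h4 (by norm_num)
    have h6 : LpBound (fun ω => sgd gradF η (fun _ => θs) ξ (k + 1) ω - θs) 2 P
        (√(1 - η * μ) * (2 * τ / μ) + |η| * τ) := by
      convert h5 using 2 with ω
      simp only [sgd]
      abel
    refine h6.mono ?_
    rw [abs_of_nonneg hη]
    calc √(1 - η * μ) * (2 * τ / μ) + η * τ ≤ (1 - η * μ / 2) * (2 * τ / μ) + η * τ := by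
          gcongr
          exact sqrt_one_sub_le hημ
      _ = _ := by field_simp; ring

end Iterates

/-! ### The corrected one-step expansion -/

section Decomposition

variable {d : ℕ} {Z : Type*} (B : E d →L[ℝ] E d →L[ℝ] E d) (f : E d → ℝ) (gradF : E d → Z → E d)
  (θs : E d) (η : ℝ)

/-- The quadratic potential whose increments along SGD telescope. -/
def potential (e : E d) : E d := e - (1 / 2 : ℝ) • B e e

/-- The linear map applied to the noise in the martingale part at `θs + e`. -/
def noiseMap (e : E d) : E d →L[ℝ] E d :=
  (1 / 2 : ℝ) • (B.flip e + B e) - ContinuousLinearMap.id ℝ (E d)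

/-- The martingale increment. -/
def increment (θ : E d) (z : Z) : E d := noiseMap B (θ - θs) (gradF θ z - gradient f θ)

/-- What is left of `H e` after removing the telescoping part, the martingale increment, and the
quadratic form of the noise at the minimizer. -/
def residual (θ : E d) (z : Z) : E d :=
  hessian f θs (θ - θs) + (η / 2) • B (gradF θs z) (gradF θs z)
    - η⁻¹ • (potential B (θ - θs) - potential B (θ - η • gradF θ z - θs))
    - increment B f gradF θs θ z

variable {B f gradF θs η}

theorem noiseMap_apply (e v : E d) : noiseMap B e v = (1 / 2 : ℝ) • (B v e + B e v) - v := by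
  simp [noiseMap]

theorem norm_bilin_le {β : ℝ} (hB : ‖B‖ ≤ β) (u v : E d) : ‖B u v‖ ≤ β * ‖u‖ * ‖v‖ :=
  (B.le_opNorm₂ u v).trans (by gcongr)

theorem norm_noiseMap_apply_le {β : ℝ} (hB : ‖B‖ ≤ β) (e v : E d) :
    ‖noiseMap B e v‖ ≤ ‖v‖ + β * (‖v‖ * ‖e‖) := by
  rw [noiseMap_apply]
  have h1 := norm_bilin_le hB v e
  have h2 := norm_bilin_le hB e v
  calc _ ≤ ‖(1 / 2 : ℝ) • (B v e + B e v)‖ + ‖v‖ := norm_sub_le _ _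
    _ ≤ 1 / 2 * (‖B v e‖ + ‖B e v‖) + ‖v‖ := by
      rw [norm_smul]
      norm_num
      exact norm_add_le _ _
    _ ≤ _ := by linarith

theorem norm_potential_le {β : ℝ} (hB : ‖B‖ ≤ β) (e : E d) :
    ‖potential B e‖ ≤ ‖e‖ + β / 2 * (‖e‖ * ‖e‖) := by
  have h1 := norm_bilin_le hB e e
  calc _ ≤ ‖e‖ + ‖(1 / 2 : ℝ) • B e e‖ := norm_sub_le _ _
    _ = ‖e‖ + 1 / 2 * ‖B e e‖ := by rw [norm_smul]; norm_num
    _ ≤ _ := by linarith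

/-- Adding the martingale increment replaces the stochastic gradient by `gradient f θ` in all terms
linear in it. The Lyapunov equation then cancels `½ T` up to Taylor errors, and only the difference
of `B` at the current noise and at the noise at `θs` survives with the factor `η / 2`. -/
theorem residual_eq {T : E d →L[ℝ] E d →L[ℝ] E d} (hη : η ≠ 0)
    (hB : ∀ u v, B (hessian f θs u) v + B u (hessian f θs v) = T u v) (θ : E d) (z : Z) :
    residual B f gradF θs η θ z =
      -(gradient f θ - hessian f θs (θ - θs) - (1 / 2 : ℝ) • T (θ - θs) (θ - θs))
      + (1 / 2 : ℝ) • (B (gradient f θ - hessian f θs (θ - θs)) (θ - θs)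
        + B (θ - θs) (gradient f θ - hessian f θs (θ - θs)))
      - (η / 2) • (B (gradF θ z - gradF θs z) (gradF θ z - gradF θs z)
        + B (gradF θ z - gradF θs z) (gradF θs z)
        + B (gradF θs z) (gradF θ z - gradF θs z)) := by
  rw [residual, increment, noiseMap_apply, ← hB, sub_right_comm θ]
  generalize θ - θs = e
  generalize gradF θ z = G
  generalize gradF θs z = G'
  generalize gradient f θ = g
  generalize hessian f θs = H
  have h1 : potential B e - potential B (e - η • G)
      = η • (G - (1 / 2 : ℝ) • (B G e + B e G) + (η / 2) • B G G) := by
    simp only [potential, map_sub, map_smul, sub_apply, smul_apply]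
    module
  rw [h1, smul_smul, inv_mul_cancel₀ hη, one_smul]
  simp only [map_sub, sub_apply]
  module

theorem norm_residual_le {L L₂ L₃ L₄ β : ℝ} (hη : 0 < η) (hs : Smooth f L₂ L₃ L₄)
    (hg : gradient f θs = 0) (h₃ : L₃ ≤ L) (h₄ : L₄ ≤ L)
    (hB : ∀ u v, B (hessian f θs u) v + B u (hessian f θs v)
      = fderiv ℝ (fderiv ℝ (gradient f)) θs u v) (hβ : ‖B‖ ≤ β) (θ : E d) (z : Z) :
    ‖residual B f gradF θs η θ z‖ ≤ (L + β * L) * ‖θ - θs‖ ^ 3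
      + η / 2 * β * (‖gradF θ z - gradF θs z‖ * ‖gradF θ z - gradF θs z‖
        + 2 * (‖gradF θ z - gradF θs z‖ * ‖gradF θs z‖)) := by
  rw [residual_eq hη.ne' hB]
  have t1 := gradient_taylor_one hs θs θ
  have t2 := gradient_taylor_two hs θs θ
  rw [hg, sub_zero] at t1 t2
  have hβ0 : 0 ≤ β := (ContinuousLinearMap.opNorm_nonneg B).trans hβ
  generalize θ - θs = e at *
  generalize gradF θ z - gradF θs z = D at *
  generalize gradF θs z = G at *
  set r := gradient f θ - hessian f θs e
  have b1 := norm_bilin_le hβ r e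
  have b2 := norm_bilin_le hβ e r
  have b3 := norm_bilin_le hβ D D
  have b4 := norm_bilin_le hβ D G
  have b5 := norm_bilin_le hβ G D
  have t2' := t2.trans (mul_le_mul_of_nonneg_right h₄ (by positivity : 0 ≤ ‖e‖ ^ 3))
  have t1' := t1.trans (mul_le_mul_of_nonneg_right h₃ (by positivity : 0 ≤ ‖e‖ ^ 2))
  have hre : β * ‖r‖ * ‖e‖ ≤ β * L * ‖e‖ ^ 3 := by
    calc β * ‖r‖ * ‖e‖ ≤ β * (L * ‖e‖ ^ 2) * ‖e‖ := by gcongr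
      _ = _ := by ring
  refine (norm_sub_le _ _).trans (add_le_add ((norm_add_le _ _).trans ?_) ?_)
  · rw [norm_neg, norm_smul]
    have := norm_add_le (B r e) (B e r)
    norm_num
    nlinarith
  · rw [norm_smul, Real.norm_of_nonneg (by positivity), mul_assoc]
    gcongr
    have := norm_add₃_le (a := B D D) (b := B D G) (c := B G D)
    nlinarith

end Decomposition

/-! ### Summing the expansion over the tail -/

section TailAverage

variable {d : ℕ} {Z Ω : Type*} {f : E d → ℝ} {gradF : E d → Z → E d} {θs : E d} {η : ℝ}
  {ξ : ℕ → Ω → Z} {B : E d →L[ℝ] E d →L[ℝ] E d} {s : Ω → E d}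

theorem tailAverage_eq (η : ℝ) (s : Ω → E d) (ξ : ℕ → Ω → Z) (n : ℕ) (ω : Ω) :
    tailAverage gradF η s ξ n ω
      = (n : ℝ)⁻¹ • ∑ i ∈ Finset.range n, sgd gradF η s ξ (n + 1 + i) ω := by
  have h1 : Finset.Icc (n + 1) (2 * n) = Finset.Ico (n + 1) (2 * n + 1) := by
    ext x; simp
  rw [tailAverage, h1, Finset.sum_Ico_eq_sum_range, show 2 * n + 1 - (n + 1) = n by omega]

theorem tailAverage_sub_eq (η : ℝ) (s : Ω → E d) (ξ : ℕ → Ω → Z) {n : ℕ} (hn : n ≠ 0) (ω : Ω) :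
    tailAverage gradF η s ξ n ω - θs
      = (n : ℝ)⁻¹ • ∑ i ∈ Finset.range n, (sgd gradF η s ξ (n + 1 + i) ω - θs) := by
  have hn' : (n : ℝ) ≠ 0 := by exact_mod_cast hn
  rw [tailAverage_eq, Finset.sum_sub_distrib, smul_sub, Finset.sum_const, Finset.card_range,
    ← Nat.cast_smul_eq_nsmul ℝ, smul_smul, inv_mul_cancel₀ hn', one_smul]

theorem hessian_tailAverage_eq {n : ℕ} (hn : n ≠ 0) (ω : Ω) :
    hessian f θs (tailAverage gradF η s ξ n ω - θs)
        + (η / 2) • (n : ℝ)⁻¹ • ∑ i ∈ Finset.range n,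
          B (gradF θs (ξ (n + 1 + i + 1) ω)) (gradF θs (ξ (n + 1 + i + 1) ω))
      = (n : ℝ)⁻¹ • η⁻¹ • (potential B (sgd gradF η s ξ (n + 1) ω - θs)
          - potential B (sgd gradF η s ξ (n + 1 + n) ω - θs))
        + (n : ℝ)⁻¹ • ∑ i ∈ Finset.range n,
          increment B f gradF θs (sgd gradF η s ξ (n + 1 + i) ω) (ξ (n + 1 + i + 1) ω)
        + (n : ℝ)⁻¹ • ∑ i ∈ Finset.range n,
          residual B f gradF θs η (sgd gradF η s ξ (n + 1 + i) ω) (ξ (n + 1 + i + 1) ω) := by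
  have htel := Finset.sum_range_sub' (fun i => potential B (sgd gradF η s ξ (n + 1 + i) ω - θs)) n
  rw [add_zero] at htel
  rw [tailAverage_sub_eq η s ξ hn, map_smul, map_sum, smul_comm (η / 2), ← htel,
    Finset.smul_sum (r := η / 2), Finset.smul_sum (r := η⁻¹), ← smul_add, ← smul_add, ← smul_add,
    ← Finset.sum_add_distrib, ← Finset.sum_add_distrib, ← Finset.sum_add_distrib]
  congr 1
  refine Finset.sum_congr rfl fun i _ => ?_
  have : sgd gradF η s ξ (n + 1 + (i + 1)) ω = sgd gradF η s ξ (n + 1 + i) ω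
      - η • gradF (sgd gradF η s ξ (n + 1 + i) ω) (ξ (n + 1 + i + 1) ω) := rfl
  rw [residual, this]
  abel

end TailAverage

/-! ### L² size of each term of the expansion -/

section Chain

variable {d : ℕ} {Z : Type*} [MeasurableSpace Z] {Pξ : Measure Z}
  {f : E d → ℝ} {gradF : E d → Z → E d} {θs : E d} {μ L L₁ L₂ L₃ L₄ τ η a β : ℝ}
  {B : E d →L[ℝ] E d →L[ℝ] E d}

theorem measurable_bilin (B : E d →L[ℝ] E d →L[ℝ] E d) {α : Type*} {mα : MeasurableSpace α}
    {X Y : α → E d} (hX : Measurable X) (hY : Measurable Y) :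
    Measurable fun x => B (X x) (Y x) :=
  B.continuous₂.measurable.comp (hX.prodMk hY)

theorem measurable_potential (B : E d →L[ℝ] E d →L[ℝ] E d) {α : Type*} {mα : MeasurableSpace α}
    {X : α → E d} (hX : Measurable X) : Measurable fun x => potential B (X x) :=
  hX.sub ((measurable_bilin B hX hX).const_smul (1 / 2 : ℝ))

theorem NoiseAssumption.measurable_increment (hn : NoiseAssumption f gradF Pξ θs 6 L₁ τ)
    (hs : Smooth f L₂ L₃ L₄) {α : Type*} {mα : MeasurableSpace α} {X : α → E d} {ζ : α → Z}
    (hX : Measurable X) (hζ : Measurable ζ) :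
    Measurable fun x => increment B f gradF θs (X x) (ζ x) := by
  have h1 : Measurable fun x => gradF (X x) (ζ x) - gradient f (X x) :=
    (hn.measurable_comp hX hζ).sub (hs.contDiff_gradient.continuous.measurable.comp hX)
  have h2 : Measurable fun x => X x - θs := hX.sub_const θs
  simp only [increment, noiseMap_apply]
  exact (((measurable_bilin B h1 h2).add (measurable_bilin B h2 h1)).const_smul (1 / 2 : ℝ)).sub h1

theorem NoiseAssumption.measurable_residual (hn : NoiseAssumption f gradF Pξ θs 6 L₁ τ)
    (hs : Smooth f L₂ L₃ L₄) {α : Type*} {mα : MeasurableSpace α} {X : α → E d} {ζ : α → Z}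
    (hX : Measurable X) (hζ : Measurable ζ) :
    Measurable fun x => residual B f gradF θs η (X x) (ζ x) := by
  have h1 : Measurable fun x => X x - θs := hX.sub_const θs
  have h2 : Measurable fun x => gradF θs (ζ x) := hn.measurable_comp measurable_const hζ
  have h3 : Measurable fun x => X x - η • gradF (X x) (ζ x) - θs :=
    (hX.sub ((hn.measurable_comp hX hζ).const_smul η)).sub_const θs
  have h4 : Measurable fun x => hessian f θs (X x - θs) :=
    (hessian f θs).continuous.measurable.comp h1
  have h5 := ((measurable_potential B h1).sub (measurable_potential B h3)).const_smul η⁻¹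
  have h6 := (measurable_bilin B h2 h2).const_smul (η / 2)
  exact ((h4.add h6).sub h5).sub (hn.measurable_increment hs hX hζ)

variable [IsProbabilityMeasure Pξ]

theorem NoiseAssumption.integrable_increment (hn : NoiseAssumption f gradF Pξ θs 6 L₁ τ)
    (hs : Smooth f L₂ L₃ L₄) (θ : E d) : Integrable (increment B f gradF θs θ) Pξ :=
  (noiseMap B (θ - θs)).integrable_comp ((hn.integrable hs θ).sub (integrable_const _))

theorem NoiseAssumption.integral_increment (hn : NoiseAssumption f gradF Pξ θs 6 L₁ τ)
    (hs : Smooth f L₂ L₃ L₄) (θ : E d) : ∫ z, increment B f gradF θs θ z ∂Pξ = 0 := by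
  have h1 := (noiseMap B (θ - θs)).integral_comp_comm
    ((hn.integrable hs θ).sub (integrable_const (gradient f θ)))
  have h2 := integral_sub (hn.integrable hs θ) (integrable_const (μ := Pξ) (gradient f θ))
  rw [hn.unbiased, integral_const] at h2
  simp only [Pi.sub_apply] at h1
  simp only [increment]
  rw [h1, h2]
  simp

variable {Ω S : Type*} [MeasurableSpace Ω] {P : Measure Ω} [IsProbabilityMeasure P]
  [MeasurableSpace S] {θ₀ : Ω → S} {ξ : ℕ → Ω → Z} {s : Ω → E d}

/-- The sum of the martingale increments along the chain. -/
theorem Driven.lpBound_sum_increment (h : Driven P Pξ θ₀ ξ)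
    (hn : NoiseAssumption f gradF Pξ θs 6 L₁ τ) (hs : Smooth f L₂ L₃ L₄)
    (hs0 : Measurable[past θ₀ ξ 0] s) (m : ℕ) {b : ℝ}
    (hb : ∀ k, LpBound (fun ω => increment B f gradF θs (sgd gradF η s ξ k ω) (ξ (k + 1) ω)) 2 P b)
    (N : ℕ) :
    LpBound (fun ω => ∑ i ∈ Finset.range N,
      increment B f gradF θs (sgd gradF η s ξ (m + i) ω) (ξ (m + i + 1) ω)) 2 P (√N * b) := by
  refine LpBound.sum_of_orthogonal (fun i => hb (m + i)) (fun k => ?_) N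
  have hS : Measurable[past θ₀ ξ (m + k)] (fun ω => ∑ i ∈ Finset.range k,
      increment B f gradF θs (sgd gradF η s ξ (m + i) ω) (ξ (m + i + 1) ω)) := by
    refine Finset.measurable_sum _ fun i hi => ?_
    -- Increment `i` uses noise of index `m + i + 1`; since `i < k`, the partial sum is known at
    -- time `m + k`, before the noise of increment `k`.
    have hik : m + i + 1 ≤ m + k := by have := Finset.mem_range.mp hi; omega
    exact hn.measurable_increment hs
      ((hn.measurable_sgd hs0 (m + i)).mono (past_mono (by omega)) le_rfl)
      (measurable_past_noise hik)
  have hU := hn.measurable_sgd (η := η) hs0 (m + k)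
  exact integral_inner_eq_zero_of_indepFun (h.indepFun (hS.prodMk hU)) (h.measurable hS)
    (h.measurable hU) (h.measurable_noise _) (h.law _)
    (hn.measurable_increment hs measurable_fst measurable_snd) (hn.integrable_increment hs)
    (hn.integral_increment hs)
    (memLp_finsetSum _ fun i _ => (hb (m + i)).memLp) (hb (m + k)).memLp

variable {X : Ω → E d} {ζ : Ω → Z}

theorem NoiseAssumption.lpBound_noise {p : ℕ} (hn : NoiseAssumption f gradF Pξ θs 6 L₁ τ)
    (hs : Smooth f L₂ L₃ L₄) (hg : gradient f θs = 0) (h₁ : L₁ ≤ L) (h₂ : L₂ ≤ L) (hp2 : 2 ≤ p)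
    (hp6 : p ≤ 6) (hX : Measurable X) (hζ : Measurable ζ) (hind : IndepFun X ζ P)
    (hlaw : P.map ζ = Pξ) (ha : LpBound (fun ω => X ω - θs) p P a) {t : ℝ}
    (ht : LpBound (gradF θs) p Pξ t) :
    LpBound (fun ω => gradF (X ω) (ζ ω) - gradient f (X ω)) p P (t + 2 * L * a) := by
  have hL : 0 ≤ L := hn.pos.le.trans h₁
  have hp : (1 : ℝ≥0∞) ≤ p := by exact_mod_cast (by omega : 1 ≤ p)
  have h3 := hn.lpBound_sub_comp hs h₁ h₂ hp2 hp6 hX hζ hind hlaw ha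
  have h4 := ht.comp_law hζ hlaw
  have h5 : LpBound (fun ω => gradient f (X ω)) p P (|L| * a) := by
    refine (ha.norm.const_mul L).of_norm_le
      (hs.contDiff_gradient.continuous.measurable.comp hX).aestronglyMeasurable fun ω => ?_
    have := hs.lipschitz (X ω) θs
    rw [hg, sub_zero] at this
    exact this.trans (by gcongr)
  have h6 := (h3.add h4 hp).sub h5 hp
  simp only [sub_add_cancel] at h6
  refine h6.mono ?_
  rw [abs_of_nonneg hL]
  linarith

/-- The identity part of `noiseMap` is measured in L², so that the trace appears with coefficient
one. The part with `B` is a product, split as L⁴ times L⁴, and costs `τ` together with a factor `a`.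
-/
theorem NoiseAssumption.lpBound_increment (hn : NoiseAssumption f gradF Pξ θs 6 L₁ τ)
    (hs : Smooth f L₂ L₃ L₄) (hg : gradient f θs = 0) (h₁ : L₁ ≤ L) (h₂ : L₂ ≤ L)
    (hβ : ‖B‖ ≤ β) (hX : Measurable X) (hζ : Measurable ζ) (hind : IndepFun X ζ P)
    (hlaw : P.map ζ = Pξ) (ha : LpBound (fun ω => X ω - θs) 6 P a) :
    LpBound (fun ω => increment B f gradF θs (X ω) (ζ ω)) 2 P
      ((√(noiseCov gradF Pξ θs).trace + 2 * L * a) + β * ((τ + 2 * L * a) * a)) := by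
  have hβ0 : 0 ≤ β := (ContinuousLinearMap.opNorm_nonneg B).trans hβ
  have h2 := hn.lpBound_noise (p := 2) hs hg h₁ h₂ (by norm_num) (by norm_num) hX hζ hind hlaw
    (by simpa using ha.mono_exponent (p := 2) (by norm_num)) (by simpa using hn.lpBound_star_two)
  have a4 := ha.mono_exponent (p := 4) (by norm_num)
  have h4 := hn.lpBound_noise (p := 4) hs hg h₁ h₂ (by norm_num) (by norm_num) hX hζ hind hlaw
    (by simpa using a4) (by simpa using hn.lpBound_star.mono_exponent (p := 4) (by norm_num))
  have h2' : LpBound (fun ω => gradF (X ω) (ζ ω) - gradient f (X ω)) 2 P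
    (√(noiseCov gradF Pξ θs).trace + 2 * L * a) := by simpa using h2
  have h4' : LpBound (fun ω => gradF (X ω) (ζ ω) - gradient f (X ω)) 4 P
    (τ + 2 * L * a) := by simpa using h4
  have h5 := h2'.norm.add ((h4'.norm.mul_four a4.norm).const_mul β) (by norm_num)
  rw [abs_of_nonneg hβ0] at h5
  exact h5.of_norm_le (hn.measurable_increment hs hX hζ).aestronglyMeasurable
    fun ω => norm_noiseMap_apply_le hβ _ _

theorem lpBound_potential (hβ : ‖B‖ ≤ β) (hX : Measurable X)
    (ha : LpBound (fun ω => X ω - θs) 6 P a) :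
    LpBound (fun ω => potential B (X ω - θs)) 2 P (a + β / 2 * (a * a)) := by
  have hβ0 : 0 ≤ β := (ContinuousLinearMap.opNorm_nonneg B).trans hβ
  have a2 := (ha.mono_exponent (p := 2) (by norm_num)).norm
  have a4 := (ha.mono_exponent (p := 4) (by norm_num)).norm
  have h5 := a2.add ((a4.mul_four a4).const_mul (β / 2)) (by norm_num)
  rw [abs_of_nonneg (by positivity)] at h5
  exact h5.of_norm_le (measurable_potential B (hX.sub_const θs)).aestronglyMeasurable
    fun ω => norm_potential_le hβ _

theorem NoiseAssumption.lpBound_residual (hn : NoiseAssumption f gradF Pξ θs 6 L₁ τ)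
    (hs : Smooth f L₂ L₃ L₄) (hg : gradient f θs = 0) (h₁ : L₁ ≤ L) (h₂ : L₂ ≤ L) (h₃ : L₃ ≤ L)
    (h₄ : L₄ ≤ L) (hη : 0 < η)
    (hB : ∀ u v, B (hessian f θs u) v + B u (hessian f θs v)
      = fderiv ℝ (fderiv ℝ (gradient f)) θs u v)
    (hβ : ‖B‖ ≤ β) (hX : Measurable X) (hζ : Measurable ζ) (hind : IndepFun X ζ P)
    (hlaw : P.map ζ = Pξ) (ha : LpBound (fun ω => X ω - θs) 6 P a) :
    LpBound (fun ω => residual B f gradF θs η (X ω) (ζ ω)) 2 P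
      ((L + β * L) * a ^ 3 + η / 2 * β * ((L * a) * (L * a) + 2 * ((L * a) * τ))) := by
  have hL : 0 ≤ L := hn.pos.le.trans h₁
  have hβ0 : 0 ≤ β := (ContinuousLinearMap.opNorm_nonneg B).trans hβ
  have a4 := ha.mono_exponent (p := 4) (by norm_num)
  have hD : LpBound (fun ω => gradF (X ω) (ζ ω) - gradF θs (ζ ω)) 4 P (L * a) := by
    simpa using hn.lpBound_sub_comp (q := 4) hs h₁ h₂ (by norm_num) (by norm_num) hX hζ hind hlaw
      (by simpa using a4)
  have hG := (hn.lpBound_star.mono_exponent (p := 4) (by norm_num)).comp_law hζ hlaw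
  have h5 := (ha.norm.cube.const_mul (L + β * L)).add
    (((hD.norm.mul_four hD.norm).add ((hD.norm.mul_four hG.norm).const_mul 2)
      (by norm_num)).const_mul (η / 2 * β)) (by norm_num)
  rw [abs_of_nonneg (by positivity), abs_of_nonneg (by positivity),
    abs_of_nonneg (by norm_num)] at h5
  exact h5.of_norm_le (hn.measurable_residual hs hX hζ).aestronglyMeasurable
    fun ω => norm_residual_le hη hs hg h₃ h₄ hB hβ _ _

/-- The `L²` error of the tail average, up to a multiple of the average of the quadratic form of
the noise at the minimizer. -/
theorem Driven.lpBound_hessian_tailAverage (h : Driven P Pξ θ₀ ξ)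
    (hn : NoiseAssumption f gradF Pξ θs 6 L₁ τ)
    (hs : Smooth f L₂ L₃ L₄) (hg : gradient f θs = 0) (h₁ : L₁ ≤ L) (h₂ : L₂ ≤ L) (h₃ : L₃ ≤ L)
    (h₄ : L₄ ≤ L) (hη : 0 < η)
    (hB : ∀ u v, B (hessian f θs u) v + B u (hessian f θs v)
      = fderiv ℝ (fderiv ℝ (gradient f)) θs u v)
    (hβ : ‖B‖ ≤ β) (hs0 : Measurable[past θ₀ ξ 0] s)
    (ha : ∀ k, LpBound (fun ω => sgd gradF η s ξ k ω - θs) 6 P a) {n : ℕ} (hn0 : n ≠ 0) :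
    LpBound (fun ω => hessian f θs (tailAverage gradF η s ξ n ω - θs)
        + (η / 2) • (n : ℝ)⁻¹ • ∑ i ∈ Finset.range n,
          B (gradF θs (ξ (n + 1 + i + 1) ω)) (gradF θs (ξ (n + 1 + i + 1) ω))) 2 P
      ((n : ℝ)⁻¹ * (η⁻¹ * (2 * (a + β / 2 * (a * a))))
        + (n : ℝ)⁻¹ * (√n * ((√(noiseCov gradF Pξ θs).trace + 2 * L * a)
          + β * ((τ + 2 * L * a) * a)))
        + ((L + β * L) * a ^ 3 + η / 2 * β * ((L * a) * (L * a) + 2 * ((L * a) * τ)))) := by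
  have hm := hn.measurable_sgd (η := η) hs0
  have hm' := fun k => h.measurable (hm k)
  have hn' : (n : ℝ) ≠ 0 := by exact_mod_cast hn0
  have e1 := (((lpBound_potential hβ (hm' (n + 1)) (ha (n + 1))).sub
    (lpBound_potential hβ (hm' (n + 1 + n)) (ha (n + 1 + n))) (by norm_num)).const_smul
      η⁻¹).const_smul (n : ℝ)⁻¹
  have e2 := (h.lpBound_sum_increment hn hs hs0 (n + 1) (fun k =>
    hn.lpBound_increment hs hg h₁ h₂ hβ (hm' k) (h.measurable_noise (k + 1)) (h.indepFun (hm k))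
      (h.law _) (ha k)) n).const_smul (n : ℝ)⁻¹
  have e3 := (LpBound.sum (s := Finset.range n) (fun i _ =>
    hn.lpBound_residual hs hg h₁ h₂ h₃ h₄ hη hB hβ (hm' (n + 1 + i))
      (h.measurable_noise (n + 1 + i + 1)) (h.indepFun (hm (n + 1 + i))) (h.law _)
      (ha (n + 1 + i))) (by norm_num)).const_smul (n : ℝ)⁻¹
  have e4 := (e1.add e2 (by norm_num)).add e3 (by norm_num)
  simp_rw [hessian_tailAverage_eq hn0]
  refine e4.mono (le_of_eq ?_)
  rw [abs_of_nonneg (by positivity), abs_of_nonneg (by positivity), Finset.sum_const,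
    Finset.card_range, nsmul_eq_mul, inv_mul_cancel_left₀ hn', two_mul (a + β / 2 * (a * a))]

end Chain

/-! ### Constants and powers of `n` -/

/-- The constant multiplying `n ^ (-3/4)` for chains whose centred `L⁶` norm is at most
`s * n ^ (-1/4)`, given the bound `β` on the solution of the Lyapunov equation. -/
def fluctuationConst (L τ s β : ℝ) : ℝ :=
  2 * (s + β / 2 * (s * s)) + (2 * L * s + β * ((τ + 2 * L * s) * s)) + (L + β * L) * s ^ 3
    + β * ((L * s) * (L * s) + 2 * ((L * s) * τ))

/-- The constant multiplying `n ^ (-3/4)` in the Richardson-Romberg bound. -/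
def rateConst (μ L τ D c : ℝ) : ℝ :=
  fluctuationConst L τ √(2 * D * τ ^ 2 / μ) (L / μ) + 2 * L * τ / μ * (2 * L * c) ^ 2

theorem fluctuationConst_nonneg {L τ s β : ℝ} (hL : 0 ≤ L) (hτ : 0 ≤ τ) (hs : 0 ≤ s)
    (hβ : 0 ≤ β) : 0 ≤ fluctuationConst L τ s β := by
  unfold fluctuationConst
  positivity

/-- Here `q = n^{-1/4}`. The window `q² ≤ η ≤ 2 q²` covers both step sizes with one constant, and `q
≤ 1` lowers every higher power of `q` to `q³`. -/
theorem fluctuation_le {L τ s β q η t : ℝ} (hL : 0 ≤ L) (hτ : 0 ≤ τ) (hs : 0 ≤ s)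
    (hβ : 0 ≤ β) (hq : 0 < q) (hq1 : q ≤ 1) (hη1 : q ^ 2 ≤ η) (hη2 : η ≤ 2 * q ^ 2) :
    q ^ 4 * (η⁻¹ * (2 * (s * q + β / 2 * ((s * q) * (s * q)))))
        + q ^ 2 * ((t + 2 * L * (s * q)) + β * ((τ + 2 * L * (s * q)) * (s * q)))
        + ((L + β * L) * (s * q) ^ 3 + η / 2 * β
          * ((L * (s * q)) * (L * (s * q)) + 2 * ((L * (s * q)) * τ)))
      ≤ q ^ 2 * t + q ^ 3 * fluctuationConst L τ s β := by
  have hη : 0 < η := lt_of_lt_of_le (by positivity) hη1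
  have hηi : q ^ 4 * η⁻¹ ≤ q ^ 2 := by
    rw [← div_eq_mul_inv, div_le_iff₀ hη]
    calc q ^ 4 = q ^ 2 * q ^ 2 := by ring
      _ ≤ q ^ 2 * η := by gcongr
  have hqq : q * q ≤ q := by nlinarith
  have h1 : q ^ 4 * (η⁻¹ * (2 * (s * q + β / 2 * ((s * q) * (s * q)))))
      ≤ q ^ 3 * (2 * (s + β / 2 * (s * s))) := by
    calc _ = (q ^ 4 * η⁻¹) * (2 * (s * q + β / 2 * (s * s) * (q * q))) := by ring
      _ ≤ q ^ 2 * (2 * (s * q + β / 2 * (s * s) * q)) := by gcongr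
      _ = _ := by ring
  have h2 : q ^ 2 * ((t + 2 * L * (s * q)) + β * ((τ + 2 * L * (s * q)) * (s * q)))
      ≤ q ^ 2 * t + q ^ 3 * (2 * L * s + β * ((τ + 2 * L * s) * s)) := by
    calc _ ≤ q ^ 2 * ((t + 2 * L * (s * q)) + β * ((τ + 2 * L * (s * 1)) * (s * q))) := by gcongr
      _ = _ := by ring
  have h3 : η / 2 * β * ((L * (s * q)) * (L * (s * q)) + 2 * ((L * (s * q)) * τ))
      ≤ q ^ 3 * (β * ((L * s) * (L * s) + 2 * ((L * s) * τ))) := by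
    calc _ = η / 2 * β * ((L * s) * (L * s) * (q * q) + 2 * ((L * s) * τ) * q) := by ring
      _ ≤ (2 * q ^ 2) / 2 * β * ((L * s) * (L * s) * q + 2 * ((L * s) * τ) * q) := by gcongr
      _ = _ := by ring
  have h4 : (L + β * L) * (s * q) ^ 3 = q ^ 3 * ((L + β * L) * s ^ 3) := by ring
  rw [h4]
  unfold fluctuationConst
  nlinarith

theorem richardsonRomberg_sub_eq {d : ℕ} {Z Ω : Type*} (gradF : E d → Z → E d) (θs : E d)
    (γ : ℝ) (s : Ω → E d) (ξ : ℕ → Ω → Z) (n : ℕ) (ω : Ω) :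
    richardsonRomberg gradF γ s ξ n ω - θs = (2 : ℝ) • (tailAverage gradF γ s ξ n ω - θs)
      - (tailAverage gradF (2 * γ) s ξ n ω - θs) := by
  simp only [richardsonRomberg]; module

theorem LpBound.hessian {d : ℕ} {f : E d → ℝ} {θs : E d} {L L₂ L₃ L₄ b : ℝ} {Ω : Type*}
    [MeasurableSpace Ω] {P : Measure Ω} (hs : Smooth f L₂ L₃ L₄) (h₂ : L₂ ≤ L) {X : Ω → E d}
    (h : LpBound X 2 P b) : LpBound (fun ω => hessian f θs (X ω)) 2 P (L * b) := by
  have h1 := h.norm.const_mul L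
  rw [abs_of_nonneg (hs.nonneg₂.trans h₂)] at h1
  refine h1.of_norm_le ((SGDRR.hessian f θs).continuous.comp_aestronglyMeasurable h.meas)
    fun ω => ((SGDRR.hessian f θs).le_opNorm _).trans ?_
  gcongr
  exact (norm_hessian_le hs θs).trans h₂

theorem sum_pow_shift_le {ρ x : ℝ} (hρ : 0 ≤ ρ) (hx : 0 < x) (hρx : ρ ≤ 1 - x / 2) (m n : ℕ) :
    ∑ i ∈ Finset.range n, ρ ^ (m + i) ≤ ρ ^ m * (2 / x) := by
  simp_rw [pow_add, ← Finset.mul_sum]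
  gcongr
  rw [le_div_iff₀ hx]
  have h1 := geom_sum_mul_neg ρ n
  have h2 : 0 ≤ ∑ i ∈ Finset.range n, ρ ^ i := Finset.sum_nonneg fun i _ => by positivity
  have h3 : 0 ≤ ρ ^ n := by positivity
  nlinarith

/-! ### The Richardson-Romberg combination -/

section RichardsonRomberg

variable {d : ℕ} {Z : Type*} [MeasurableSpace Z] {Pξ : Measure Z} [IsProbabilityMeasure Pξ]
  {f : E d → ℝ} {gradF : E d → Z → E d} {θs : E d} {μ L L₁ L₂ L₃ L₄ τ D c γ η b : ℝ}
  {Ω S : Type*} [MeasurableSpace Ω] {P : Measure Ω} [IsProbabilityMeasure P]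
  [MeasurableSpace S] {θ₀ : Ω → S} {ξ : ℕ → Ω → Z} {s t : Ω → E d}

/-- Two tail averages driven by the same noise forget their starting points. -/
theorem Driven.lpBound_tailAverage_sub (h : Driven P Pξ θ₀ ξ)
    (hn : NoiseAssumption f gradF Pξ θs 6 L₁ τ)
    (hs : Smooth f L₂ L₃ L₄) (hc : StronglyConvex f μ) (hγ : 0 < γ) (hγη : γ ≤ η)
    (hηL : η * L₁ ≤ 1) (hημ : η * μ ≤ 1) (hs0 : Measurable[past θ₀ ξ 0] s)
    (ht0 : Measurable[past θ₀ ξ 0] t) (hb : LpBound (fun ω => s ω - t ω) 2 P b) (n : ℕ) :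
    LpBound (fun ω => tailAverage gradF η s ξ n ω - tailAverage gradF η t ξ n ω) 2 P
      (2 * √(1 - γ * μ) ^ (n + 1) / (n * γ * μ) * b) := by
  have hμ := hc.pos
  have hb0 := hb.nonneg
  have hle : γ * μ ≤ η * μ := by gcongr
  have h1 := (LpBound.sum (s := Finset.range n) (fun i _ =>
    h.lpBound_sgd_sub hn hs hc (hγ.le.trans hγη) hηL hημ hs0 ht0 hb (n + 1 + i))
    (by norm_num)).const_smul (n : ℝ)⁻¹
  simp_rw [tailAverage_eq, ← smul_sub, ← Finset.sum_sub_distrib]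
  refine h1.mono ?_
  rw [abs_of_nonneg (by positivity), ← Finset.sum_mul]
  -- The larger step `η` contracts at least as fast, so a bound in terms of `γ` alone serves both
  -- chains.
  have h2 : ∑ i ∈ Finset.range n, √(1 - η * μ) ^ (n + 1 + i)
      ≤ √(1 - γ * μ) ^ (n + 1) * (2 / (γ * μ)) := by
    refine le_trans (Finset.sum_le_sum fun i _ => ?_) (sum_pow_shift_le (Real.sqrt_nonneg _)
      (mul_pos hγ hμ) (sqrt_one_sub_le (hle.trans hημ)) (n + 1) n)
    gcongr
  calc _ ≤ (n : ℝ)⁻¹ * (√(1 - γ * μ) ^ (n + 1) * (2 / (γ * μ)) * b) := by gcongr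
    _ = _ := by rw [div_eq_mul_inv, div_eq_mul_inv, mul_assoc (n : ℝ), mul_inv]; ring

theorem Driven.lpBound_hessian_richardsonRomberg_sub (h : Driven P Pξ θ₀ ξ)
    (hn : NoiseAssumption f gradF Pξ θs 6 L₁ τ)
    (hs : Smooth f L₂ L₃ L₄) (hc : StronglyConvex f μ) (h₂ : L₂ ≤ L) (hγ : 0 < γ)
    (hηL : 2 * γ * L₁ ≤ 1) (hημ : 2 * γ * μ ≤ 1) (hs0 : Measurable[past θ₀ ξ 0] s)
    (ht0 : Measurable[past θ₀ ξ 0] t) (hb : LpBound (fun ω => s ω - t ω) 2 P b) (n : ℕ) :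
    LpBound (fun ω => hessian f θs (richardsonRomberg gradF γ s ξ n ω
      - richardsonRomberg gradF γ t ξ n ω)) 2 P
      (6 * (L * √(1 - γ * μ) ^ (n + 1) / (n * γ * μ) * b)) := by
  have hμ := hc.pos
  have hL1 := hn.pos
  have h1 := (h.lpBound_tailAverage_sub hn hs hc hγ le_rfl (by nlinarith) (by nlinarith)
    hs0 ht0 hb n).const_smul 2
  have h2 := h.lpBound_tailAverage_sub hn hs hc hγ (by linarith : γ ≤ 2 * γ) hηL hημ hs0 ht0 hb n
  have h3 := (h1.sub h2 (by norm_num)).hessian (θs := θs) hs h₂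
  have h4 : ∀ ω, richardsonRomberg gradF γ s ξ n ω - richardsonRomberg gradF γ t ξ n ω
      = (2 : ℝ) • (tailAverage gradF γ s ξ n ω - tailAverage gradF γ t ξ n ω)
        - (tailAverage gradF (2 * γ) s ξ n ω - tailAverage gradF (2 * γ) t ξ n ω) := fun ω => by
    simp only [richardsonRomberg]; module
  simp_rw [h4]
  refine h3.mono (le_of_eq ?_)
  rw [abs_of_nonneg (by norm_num)]
  ring

/-- A bound without rate, valid for all step sizes in the stability range. -/
theorem Driven.lpBound_richardsonRomberg_star_crude (h : Driven P Pξ θ₀ ξ)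
    (hn : NoiseAssumption f gradF Pξ θs 6 L₁ τ)
    (hs : Smooth f L₂ L₃ L₄) (hc : StronglyConvex f μ) (h₂ : L₂ ≤ L) (hγ : 0 < γ)
    (hηL : 2 * γ * L₁ ≤ 1) (hημ : 2 * γ * μ ≤ 1) {n : ℕ} (hn0 : n ≠ 0) :
    LpBound (fun ω => hessian f θs (richardsonRomberg gradF γ (fun _ => θs) ξ n ω - θs)) 2 P
      (3 * (2 * L * τ / μ)) := by
  have hμ := hc.pos
  have hL1 := hn.pos
  have hn' : (n : ℝ) ≠ 0 := by exact_mod_cast hn0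
  have key : ∀ η, 0 ≤ η → η * L₁ ≤ 1 → η * μ ≤ 1 →
      LpBound (fun ω => tailAverage gradF η (fun _ => θs) ξ n ω - θs) 2 P (2 * τ / μ) := by
    intro η hη h1 h2
    have h3 := (LpBound.sum (s := Finset.range n) (fun i _ =>
      h.lpBound_sgd_star_two hn hs hc hη h1 h2 (n + 1 + i)) (by norm_num)).const_smul (n : ℝ)⁻¹
    simp_rw [tailAverage_sub_eq η _ ξ hn0]
    refine h3.mono (le_of_eq ?_)
    rw [abs_of_nonneg (by positivity), Finset.sum_const, Finset.card_range, nsmul_eq_mul,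
      inv_mul_cancel_left₀ hn']
  have h1 := (((key γ hγ.le (by nlinarith) (by nlinarith)).const_smul 2).sub
    (key (2 * γ) (by linarith) hηL hημ) (by norm_num)).hessian (θs := θs) hs h₂
  simp_rw [richardsonRomberg_sub_eq]
  refine h1.mono (le_of_eq ?_)
  rw [abs_of_nonneg (by norm_num)]
  ring

/-- The error of the Richardson-Romberg estimator started at the minimizer. -/
theorem Driven.lpBound_richardsonRomberg_star (h : Driven P Pξ θ₀ ξ) (hd : 0 < d)
    (hn : NoiseAssumption f gradF Pξ θs 6 L₁ τ)
    (hs : Smooth f L₂ L₃ L₄) (hc : StronglyConvex f μ) (hg : gradient f θs = 0)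
    (h₁ : L₁ ≤ L) (h₂ : L₂ ≤ L) (h₃ : L₃ ≤ L) (h₄ : L₄ ≤ L)
    (hm : MomentCondition gradF Pξ θs 6 μ L τ D c) (hγ : 0 < γ) (hγL : 2 * γ ≤ 1 / (L * c))
    {n : ℕ} {q : ℝ} (hq : 0 < q) (hq1 : q ≤ 1) (hγq : γ = q ^ 2) (hn4 : (n : ℝ)⁻¹ = q ^ 4)
    (hn2 : (n : ℝ)⁻¹ * √n = q ^ 2) :
    LpBound (fun ω => hessian f θs (richardsonRomberg gradF γ (fun _ => θs) ξ n ω - θs)) 2 P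
      (3 * (q ^ 2 * √(noiseCov gradF Pξ θs).trace
        + q ^ 3 * fluctuationConst L τ √(2 * D * τ ^ 2 / μ) (L / μ))) := by
  have hμ := hc.pos
  have hL : 0 < L := hn.pos.trans_le h₁
  have hμL : μ ≤ L := (convexity_le_smoothness hd hc hs).trans h₂
  have hτ := hn.moment.1
  have hD := hm.two_le_D
  have hn0 : n ≠ 0 := by
    rintro rfl
    simp at hn4
    exact absurd hn4.symm (by positivity)
  obtain ⟨B, hB, hBn⟩ := exists_lyapunov_solution hμ hL hμL (hessian_coercive hc hs θs)
    ((norm_hessian_le hs θs).trans h₂) (fderiv ℝ (fderiv ℝ (gradient f)) θs)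
  have hβ : ‖B‖ ≤ L / μ := hBn.trans (by
    gcongr
    exact (norm_fderiv_hessian_le hs θs).trans h₃)
  set r := √(2 * D * τ ^ 2 / μ) with hr
  have ha : ∀ η, 0 < η → η ≤ 2 * γ → ∀ k,
      LpBound (fun ω => sgd gradF η (fun _ => θs) ξ k ω - θs) 6 P (r * q) := by
    intro η h0 h1 k
    refine (h.lpBound_sgd_star_six hn hm h0 (h1.trans hγL) hμ k).mono ?_
    rw [Real.sqrt_le_left (by positivity), mul_pow, hr, Real.sq_sqrt (by positivity), ← hγq]
    calc D * η * τ ^ 2 / μ ≤ D * (2 * γ) * τ ^ 2 / μ := by gcongr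
      _ = _ := by ring
  have key : ∀ η, q ^ 2 ≤ η → η ≤ 2 * q ^ 2 →
      LpBound (fun ω => hessian f θs (tailAverage gradF η (fun _ => θs) ξ n ω - θs)
        + (η / 2) • (n : ℝ)⁻¹ • ∑ i ∈ Finset.range n,
          B (gradF θs (ξ (n + 1 + i + 1) ω)) (gradF θs (ξ (n + 1 + i + 1) ω))) 2 P
        (q ^ 2 * √(noiseCov gradF Pξ θs).trace + q ^ 3 * fluctuationConst L τ r (L / μ)) := by
    intro η h1 h2
    have hη : 0 < η := lt_of_lt_of_le (by positivity) h1
    refine (h.lpBound_hessian_tailAverage hn hs hg h₁ h₂ h₃ h₄ hη hB hβ measurable_const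
      (ha η hη (by rw [hγq]; exact h2)) hn0).mono ?_
    rw [← mul_assoc (n : ℝ)⁻¹ √n, hn2, hn4]
    exact fluctuation_le hL.le hτ (Real.sqrt_nonneg _) (by positivity) hq hq1 h1 h2
  have h1 := ((key γ hγq.ge (by rw [hγq]; nlinarith [sq_nonneg q])).const_smul 2).sub
    (key (2 * γ) (by rw [hγq]; nlinarith [sq_nonneg q]) (by rw [hγq])) (by norm_num)
  refine LpBound.mono (a := |2| * (q ^ 2 * √(noiseCov gradF Pξ θs).trace
    + q ^ 3 * fluctuationConst L τ r (L / μ)) + (q ^ 2 * √(noiseCov gradF Pξ θs).trace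
    + q ^ 3 * fluctuationConst L τ r (L / μ))) ?_ (by
      rw [abs_of_nonneg (by norm_num)]; linarith)
  -- The quadratic forms of the noise enter with weights `2 · (γ / 2)` and `(2γ) / 2` and cancel for
  -- every `ω`.
  convert h1 using 2 with ω
  rw [richardsonRomberg_sub_eq, map_sub, map_smul]
  module

/-- The error of the Richardson-Romberg estimator started at the minimizer, for all admissible
sample sizes. -/
theorem Driven.lpBound_richardsonRomberg_star_rate (h : Driven P Pξ θ₀ ξ) (hd : 0 < d)
    (hn : NoiseAssumption f gradF Pξ θs 6 L₁ τ)
    (hs : Smooth f L₂ L₃ L₄) (hc : StronglyConvex f μ) (hg : gradient f θs = 0)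
    (h₁ : L₁ ≤ L) (h₂ : L₂ ≤ L) (h₃ : L₃ ≤ L) (h₄ : L₄ ≤ L)
    (hm : MomentCondition gradF Pξ θs 6 μ L τ D c) (hγ : 0 < γ) (hγL : 2 * γ * L ≤ 1)
    {n : ℕ} {q : ℝ} (hq : 0 < q) (hq1 : q ≤ 1) (hγq : γ = q ^ 2) (hn4 : (n : ℝ)⁻¹ = q ^ 4)
    (hn2 : (n : ℝ)⁻¹ * √n = q ^ 2) :
    LpBound (fun ω => hessian f θs (richardsonRomberg gradF γ (fun _ => θs) ξ n ω - θs)) 2 P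
      (3 * (q ^ 2 * √(noiseCov gradF Pξ θs).trace + q ^ 3 * rateConst μ L τ D c)) := by
  have hμ := hc.pos
  have hL : 0 < L := hn.pos.trans_le h₁
  have hμL : μ ≤ L := (convexity_le_smoothness hd hc hs).trans h₂
  have hτ := hn.moment.1
  have hc2 := hm.two_le_c
  have hF := fluctuationConst_nonneg hL.le hτ (Real.sqrt_nonneg (2 * D * τ ^ 2 / μ))
    (by positivity : 0 ≤ L / μ)
  have hn0 : n ≠ 0 := by
    rintro rfl
    simp at hn4
    exact absurd hn4.symm (by positivity)
  unfold rateConst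
  rcases le_or_gt (2 * γ) (1 / (L * c)) with hle | hgt
  · refine (h.lpBound_richardsonRomberg_star hd hn hs hc hg h₁ h₂ h₃ h₄ hm hγ hle hq hq1 hγq hn4
      hn2).mono ?_
    gcongr
    exact le_add_of_nonneg_right (by positivity)
  -- Now `2 L c q² > 1`, that is `n < (2 L c)²`. Then `q³ (2 L c)² ≥ 1`, and the second summand of
  -- `rateConst` dominates the crude bound.
  · refine (h.lpBound_richardsonRomberg_star_crude hn hs hc h₂ hγ
      (le_trans (by gcongr) hγL) (le_trans (by gcongr) hγL) hn0).mono ?_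
    have h1 : 1 ≤ 2 * L * c * q ^ 2 := by
      rw [div_lt_iff₀ (by positivity), hγq] at hgt
      linarith
    have h2 : 1 ≤ q ^ 3 * (2 * L * c) ^ 2 := by
      calc (1 : ℝ) ≤ (2 * L * c * q ^ 2) ^ 2 := one_le_pow₀ h1
        _ = q ^ 3 * (2 * L * c) ^ 2 * q := by ring
        _ ≤ q ^ 3 * (2 * L * c) ^ 2 * 1 := by gcongr
        _ = _ := mul_one _
    gcongr
    have h3 : 0 ≤ q ^ 2 * √(noiseCov gradF Pξ θs).trace := by positivity
    have h4 : 0 ≤ q ^ 3 * fluctuationConst L τ √(2 * D * τ ^ 2 / μ) (L / μ) := by positivity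
    have h5 : 2 * L * τ / μ * 1 ≤ 2 * L * τ / μ * (q ^ 3 * (2 * L * c) ^ 2) := by gcongr
    linarith

end RichardsonRomberg

/-! ### Passage to the stated form -/

theorem eLpNorm_sub_eq_rootMoment {d : ℕ} {Ω : Type*} [MeasurableSpace Ω] {P : Measure Ω}
    {θ₀ : Ω → E d} (hθ : Measurable θ₀) (θs : E d) :
    eLpNorm (fun ω => θ₀ ω - θs) 2 P = rootMoment θs 2 (P.map θ₀) := by
  have hm : Measurable fun θ : E d => ‖θ - θs‖ₑ ^ 2 :=
    (measurable_id.sub_const θs).enorm.pow_const 2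
  rw [rootMoment, lintegral_map hm hθ, ← eLpNorm_natCast_pow _ two_ne_zero, ← ENNReal.rpow_natCast, ← ENNReal.rpow_mul]
  simp

theorem sgd_congr {d : ℕ} {Z Ω : Type*} (gradF : E d → Z → E d) (γ : ℝ) {s t : Ω → E d}
    {ξ ζ : ℕ → Ω → Z} {ω : Ω} (hs : s ω = t ω) (hξ : ∀ k, ξ k ω = ζ k ω) (k : ℕ) :
    sgd gradF γ s ξ k ω = sgd gradF γ t ζ k ω := by
  induction k with
  | zero => exact hs
  | succ k ih => simp only [sgd, ih, hξ]

theorem richardsonRomberg_congr {d : ℕ} {Z Ω : Type*} (gradF : E d → Z → E d) (γ : ℝ)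
    {s t : Ω → E d} {ξ ζ : ℕ → Ω → Z} {ω : Ω} (hs : s ω = t ω) (hξ : ∀ k, ξ k ω = ζ k ω) (n : ℕ) :
    richardsonRomberg gradF γ s ξ n ω = richardsonRomberg gradF γ t ζ n ω := by
  simp only [richardsonRomberg, tailAverage, sgd_congr gradF _ hs hξ]

/-- Up to modification on a null set, the driving randomness is measurable. -/
theorem exists_driven {Ω S Z : Type*} [MeasurableSpace Ω] [MeasurableSpace S] [MeasurableSpace Z]
    {P : Measure Ω} {Pξ : Measure Z} {ν : Measure S} {θ₀ : Ω → S}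
    {ξ : ℕ → Ω → Z} (hθ : HasLaw θ₀ ν P) (hξ : ∀ k, HasLaw (ξ k) Pξ P) (hi : iIndepFun ξ P)
    (h0 : IndepFun θ₀ (fun ω k => ξ k ω) P) :
    ∃ (s : Ω → S) (ζ : ℕ → Ω → Z), Driven P Pξ s ζ ∧ P.map s = ν ∧
      ∀ᵐ ω ∂P, θ₀ ω = s ω ∧ ∀ k, ξ k ω = ζ k ω := by
  have hs := hθ.aemeasurable.ae_eq_mk
  have hζ := fun k => (hξ k).aemeasurable.ae_eq_mk
  have hall : ∀ᵐ ω ∂P, ∀ k, ξ k ω = (hξ k).aemeasurable.mk (ξ k) ω := ae_all_iff.mpr hζ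
  refine ⟨hθ.aemeasurable.mk θ₀, fun k => (hξ k).aemeasurable.mk (ξ k),
    ⟨hθ.aemeasurable.measurable_mk, fun k => (hξ k).aemeasurable.measurable_mk, fun k => ?_,
      hi.congr hζ, h0.congr hs ?_⟩, ?_, hs.and hall⟩
  · rw [← Measure.map_congr (hζ k), (hξ k).map_eq]
  · filter_upwards [hall] with ω hω
    ext k
    exact hω k
  · rw [← Measure.map_congr hs, hθ.map_eq]

end SGDRR

end

theorem mainTheorem4 :
    ∃ c₀ : ℝ, 0 < c₀ ∧
    ∃ C : ℝ → ℝ → ℝ → ℝ → ℝ → ℝ,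
    ∀ (d : ℕ), 0 < d →
    ∀ (Z : Type*) [MeasurableSpace Z] (Pξ : Measure Z) [IsProbabilityMeasure Pξ]
      (f : SGDRR.E d → ℝ) (gradF : SGDRR.E d → Z → SGDRR.E d) (θs : SGDRR.E d)
      (μ L₁ L₂ L₃ L₄ L τ₄ τ₆ D₄ D₆ c₆ : ℝ),
      L = max (max L₁ L₂) (max L₃ L₄) →
      SGDRR.StronglyConvex f μ →
      SGDRR.Smooth f L₂ L₃ L₄ →
      IsMinOn f Set.univ θs →
      SGDRR.NoiseAssumption f gradF Pξ θs 6 L₁ τ₆ →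
      SGDRR.MomentCondition gradF Pξ θs 6 μ L τ₆ D₆ c₆ →
      SGDRR.NoiseMomentBound gradF Pξ θs 4 τ₄ →
      2 ≤ D₄ →
    ∀ (Ω : Type*) [MeasurableSpace Ω] (P : Measure Ω) [IsProbabilityMeasure P]
      (ν : Measure (SGDRR.E d)) (θ₀ : Ω → SGDRR.E d) (ξ : ℕ → Ω → Z),
      HasLaw θ₀ ν P →
      (∀ k, HasLaw (ξ k) Pξ P) →
      iIndepFun ξ P →
      IndepFun θ₀ (fun ω k => ξ k ω) P →
    ∀ n : ℕ, (L * c₆) ^ 2 ≤ (n : ℝ) →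
      eLpNorm (fun ω => SGDRR.hessian f θs
          (SGDRR.richardsonRomberg gradF ((n : ℝ) ^ (-(1 / 2) : ℝ)) θ₀ ξ n ω - θs)) 2 P ≤
        ENNReal.ofReal c₀ *
          (ENNReal.ofReal (√(SGDRR.noiseCov gradF Pξ θs).trace / √(n : ℝ)) +
            ENNReal.ofReal (C μ L τ₆ D₆ c₆ * (n : ℝ) ^ (-(3 / 4) : ℝ)) +
            SGDRR.remainder₄ θs μ L τ₄ D₄ n ((n : ℝ) ^ (-(1 / 2) : ℝ)) ν) := by
  -- The 6 is the cost of the coupling: a factor 2 for the geometric sum, times the total weight 3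
  -- of the combination. The chain from `θs` needs only 3.
  refine ⟨6, by norm_num, SGDRR.rateConst, ?_⟩
  intro d hd Z _ Pξ _ f gradF θs μ L₁ L₂ L₃ L₄ L τ₄ τ₆ D₄ D₆ c₆ hLdef hc hs hmin hn hm _ _
    Ω _ P _ ν θ₀ ξ hθ hξ hi h0 n hnL
  obtain ⟨s, ζ, h, hν, hae⟩ := SGDRR.exists_driven hθ hξ hi h0
  have h₁ : L₁ ≤ L := by rw [hLdef]; exact (le_max_left _ _).trans (le_max_left _ _)
  have h₂ : L₂ ≤ L := by rw [hLdef]; exact (le_max_right _ _).trans (le_max_left _ _)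
  have h₃ : L₃ ≤ L := by rw [hLdef]; exact (le_max_left _ _).trans (le_max_right _ _)
  have h₄ : L₄ ≤ L := by rw [hLdef]; exact (le_max_right _ _).trans (le_max_right _ _)
  have hμ := hc.pos
  have hL : 0 < L := hn.pos.trans_le h₁
  have hμL : μ ≤ L := (SGDRR.convexity_le_smoothness hd hc hs).trans h₂
  have hg := SGDRR.gradient_eq_zero_of_isMinOn hmin
  have hc2 := hm.two_le_c
  have hn0' : (0 : ℝ) < n := lt_of_lt_of_le (by positivity) hnL
  have hn1 : (1 : ℝ) ≤ n := by exact_mod_cast (by exact_mod_cast hn0' : 0 < n)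
  set γ : ℝ := (n : ℝ) ^ (-(1 / 2) : ℝ) with hγdef
  have hγsqrt : γ = (√(n : ℝ))⁻¹ := by rw [hγdef, Real.rpow_neg hn0'.le, Real.sqrt_eq_rpow]
  have hγ : 0 < γ := by positivity
  -- Because `c₆ ≥ 2`, the doubled step is always in the range of the L² contraction, although it
  -- may leave that of the moment condition.
  have hγL : 2 * γ * L ≤ 1 := by
    have h1 : L * c₆ ≤ √(n : ℝ) := Real.le_sqrt_of_sq_le hnL
    have h2 : 2 * L ≤ √(n : ℝ) := le_trans (by nlinarith) h1
    rw [hγsqrt]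
    calc 2 * (√(n : ℝ))⁻¹ * L = 2 * L / √(n : ℝ) := by rw [div_eq_mul_inv]; ring
      _ ≤ 1 := (div_le_one (by positivity)).mpr h2
  set q : ℝ := (n : ℝ) ^ (-(1 / 4) : ℝ) with hqdef
  have hq : 0 < q := by positivity
  have hq1 : q ≤ 1 := Real.rpow_le_one_of_one_le_of_nonpos hn1 (by norm_num)
  have hqpow : ∀ k : ℕ, q ^ k = (n : ℝ) ^ (-(1 / 4) * (k : ℝ)) := fun k => by
    rw [hqdef, Real.rpow_mul hn0'.le, Real.rpow_natCast]
  have hγq : γ = q ^ 2 := by rw [hqpow, hγdef]; norm_num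
  have hn4 : (n : ℝ)⁻¹ = q ^ 4 := by rw [hqpow, ← Real.rpow_neg_one]; norm_num
  have hq3 : (n : ℝ) ^ (-(3 / 4) : ℝ) = q ^ 3 := by rw [hqpow]; norm_num
  have hn2 : (n : ℝ)⁻¹ * √(n : ℝ) = q ^ 2 := by
    rw [← hγq, hγsqrt]
    have := Real.mul_self_sqrt hn0'.le
    field_simp
    linarith
  have hγμ : 2 * γ * μ ≤ 1 := le_trans (by gcongr) hγL
  have hcongr : eLpNorm (fun ω => SGDRR.hessian f θs
      (SGDRR.richardsonRomberg gradF γ θ₀ ξ n ω - θs)) 2 P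
      = eLpNorm (fun ω => SGDRR.hessian f θs
      (SGDRR.richardsonRomberg gradF γ s ζ n ω - θs)) 2 P := by
    refine eLpNorm_congr_ae ?_
    filter_upwards [hae] with ω hω
    rw [SGDRR.richardsonRomberg_congr gradF γ hω.1 hω.2]
  rw [hcongr]
  have hρ : √(1 - γ * μ) ^ (n + 1) = (1 - γ * μ) ^ (((n : ℝ) + 1) / 2) := by
    rw [Real.sqrt_eq_rpow, ← Real.rpow_natCast, ← Real.rpow_mul (by linarith)]
    congr 1
    push_cast
    ring
  have hbase : 0 < 1 - γ * μ := by nlinarith [mul_pos hγ hμ]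
  have hpre : 0 < L * (1 - γ * μ) ^ (((n : ℝ) + 1) / 2) / (n * γ * μ) := by positivity
  -- An infinite second moment makes the remainder infinite, its prefactor being strictly positive.
  by_cases htop : SGDRR.rootMoment θs 2 ν = ⊤
  · have : SGDRR.remainder₄ θs μ L τ₄ D₄ n γ ν = ⊤ := by
      rw [SGDRR.remainder₄, htop, add_top, top_add]
      exact ENNReal.mul_top (by simpa using hpre)
    rw [this, add_top, ENNReal.mul_top (by simp)]
    exact le_top
  have hb : SGDRR.LpBound (fun ω => s ω - θs) 2 P (SGDRR.rootMoment θs 2 ν).toReal := by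
    refine ⟨(h.measurable_start.sub_const θs).aestronglyMeasurable, ENNReal.toReal_nonneg, ?_⟩
    rw [SGDRR.eLpNorm_sub_eq_rootMoment h.measurable_start, hν, ENNReal.ofReal_toReal htop]
  have e1 := h.lpBound_hessian_richardsonRomberg_sub (t := fun _ => θs) hn hs hc h₂ hγ
    (le_trans (by gcongr) hγL) hγμ (SGDRR.measurable_past_start 0) measurable_const hb n
  have e2 := h.lpBound_richardsonRomberg_star_rate hd hn hs hc hg h₁ h₂ h₃ h₄ hm hγ hγL hq hq1 hγq
    hn4 hn2
  have e3 := (e1.add e2 (by norm_num)).le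
  simp only [← map_add, sub_add_sub_cancel] at e3
  refine e3.trans ?_
  have hrate : 0 ≤ SGDRR.rateConst μ L τ₆ D₆ c₆ :=
    add_nonneg (SGDRR.fluctuationConst_nonneg hL.le hn.moment.1 (Real.sqrt_nonneg _)
      (by positivity)) (by have := hn.moment.1; positivity)
  rw [hρ, hq3]
  have htr : √(SGDRR.noiseCov gradF Pξ θs).trace / √(n : ℝ)
      = q ^ 2 * √(SGDRR.noiseCov gradF Pξ θs).trace := by
    rw [← hγq, hγsqrt, div_eq_inv_mul]
  rw [htr, mul_comm (SGDRR.rateConst μ L τ₆ D₆ c₆)]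
  have hrem : ENNReal.ofReal (L * (1 - γ * μ) ^ (((n : ℝ) + 1) / 2) / (n * γ * μ)
      * (SGDRR.rootMoment θs 2 ν).toReal) ≤ SGDRR.remainder₄ θs μ L τ₄ D₄ n γ ν := by
    rw [ENNReal.ofReal_mul hpre.le, ENNReal.ofReal_toReal htop, SGDRR.remainder₄]
    gcongr
    -- Of the four summands in the remainder, only the second-moment one is needed.
    exact le_trans le_add_self le_self_add
  calc _ ≤ ENNReal.ofReal (6 * (q ^ 2 * √(SGDRR.noiseCov gradF Pξ θs).trace
        + q ^ 3 * SGDRR.rateConst μ L τ₆ D₆ c₆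
        + L * (1 - γ * μ) ^ (((n : ℝ) + 1) / 2) / (n * γ * μ)
          * (SGDRR.rootMoment θs 2 ν).toReal)) := by
        refine ENNReal.ofReal_le_ofReal ?_
        have h1 : 0 ≤ q ^ 2 * √(SGDRR.noiseCov gradF Pξ θs).trace
          + q ^ 3 * SGDRR.rateConst μ L τ₆ D₆ c₆ := by positivity
        linarith
    _ ≤ _ := by
        rw [ENNReal.ofReal_mul (by norm_num), ENNReal.ofReal_add (by positivity)
          (mul_nonneg hpre.le ENNReal.toReal_nonneg),
          ENNReal.ofReal_add (by positivity) (by positivity)]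
        gcongr
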